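/- Let $M$ be a closed (compact, without boundary) smooth manifold of dimension $n\ge 2$, let $T>0$, let $g=g(t)$ be a family of Riemannian metrics and $f=f(x,t)$ a function, both of class $C^2$ on $M\times[0,T]$, and let $m\in[n,\infty)$; if $m=n$, suppose in addition that $f(\cdot,t)$ is constant on $M$ for each $t$. All of $\nabla$, $\langle\cdot,\cdot\rangle$, $|\cdot|$, $\Delta$ and $\mathrm{Ric}$ refer to the metric $g(t)$. Set $\Delta_f w=\Delta w-\langle\nabla f,\nabla w\rangle$ and $$\mathrm{Ric}^m_f(g)=\mathrm{Ric}(g)+\nabla\nabla f-\frac{\nabla f\otimes\nabla f}{m-n},$$ where the last term is omitted if $m=n$. Let $1<p\le 1+1/\sqrt{m-1}$ and let $\mathscr N=\mathscr N(t,x,u)$ be a real function that, for each $t\in(0,T]$, is of class $C^1$ in $(x,u)\in M\times(0,\infty)$. Let $u$ be a positive function, smooth on $M\times[0,T]$, with $$\partial_t u-\Delta_f u^p=\mathscr N(t,x,u)\qquad\text{on } M\times(0,T],$$ and put $$v=\frac{p\,u^{p-1}}{p-1},\qquad \Sigma(t,x,v)=p\left[\frac{(p-1)v}{p}\right]^{\frac{p-2}{p-1}}\mathscr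 N\!\left(t,x,\left[\frac{(p-1)v}{p}\right]^{\frac1{p-1}}\right).$$ Write $\Sigma_v$ for the derivative of $\Sigma$ in its last argument, and $\Sigma_x$ for the gradient of $\Sigma$ in $x$ with $t$ and the last argument frozen. Assume that for a constant $\mathsf k\ge 0$ the super flow inequality $$\tfrac12\,\partial_t g+(p-1)\,v\,\mathrm{Ric}^m_f(g)\ \ge\ -\mathsf k\, g$$ holds (as an inequality of quadratic forms) on $M\times(0,T]$, and that at every $(x,t)\in M\times(0,T]$, with $v=v(x,t)$, $$\Sigma(t,x,v)\le 0,\qquad \langle\nabla v,\Sigma_x(t,x,v)\rangle\le 0,\qquad \Sigma_v(t,x,v)+\frac{\Sigma(t,x,v)}{2(p-1)v}\le 0 .$$ Then for all $x\in M$ and $0<t\le T$, $$\frac{p^2t}{1+2\mathsf k t}\,\bigl[v^{\frac1{p-1}}|\nabla v|^2\bigr](x,t)\ \le\ (p-1)\Bigl[\max_{M}v^{\frac p{p-1}}(\cdot,0)-v^{\frac p{p-1}}(x,t)\Bigr].$$ -/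

import Mathlib

open scoped Manifold ContDiff

noncomputable section

namespace NPME

/-! ### Tensor calculus in local coordinates on an open subset of `ℝⁿ` -/

/-- The model space `ℝⁿ`. -/
abbrev Model (n : ℕ) : Type := EuclideanSpace ℝ (Fin n)

/-- The partial derivative `∂F/∂xᵢ` at `z` of a real function of `n` real variables. -/
def pd {n : ℕ} (i : Fin n) (F : Model n → ℝ) (z : Model n) : ℝ :=
  fderiv ℝ F z (EuclideanSpace.single i 1)

/-- The Christoffel symbol
`Γᵏᵢⱼ = ½ ∑_ℓ g^{kℓ} (∂ᵢ g_{jℓ} + ∂ⱼ g_{iℓ} - ∂_ℓ g_{ij})` of the metric with components `G`. -/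
def christoffel {n : ℕ} (G : Model n → Matrix (Fin n) (Fin n) ℝ) (k i j : Fin n)
    (z : Model n) : ℝ :=
  (1 / 2) * ∑ l, (G z)⁻¹ k l *
    (pd i (fun y => G y j l) z + pd j (fun y => G y i l) z - pd l (fun y => G y i j) z)

/-- The components of the Ricci tensor:
`Rᵢⱼ = ∂ₖ Γᵏᵢⱼ - ∂ᵢ Γ^ℓ_{ℓj} + Γᵏᵢⱼ Γ^ℓ_{ℓk} - Γ^ℓ_{ik} Γᵏ_{ℓj}` (repeated indices are summed). -/
def ricciCoord {n : ℕ} (G : Model n → Matrix (Fin n) (Fin n) ℝ) (z : Model n)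
    (i j : Fin n) : ℝ :=
  (∑ k, pd k (christoffel G k i j) z) - (∑ l, pd i (christoffel G l l j) z)
    + ∑ k, ∑ l, (christoffel G k i j z * christoffel G l l k z
        - christoffel G l i k z * christoffel G k l j z)

/-- The components of the Hessian (second covariant derivative) of a function:
`∂ᵢ∂ⱼ φ - Γᵏᵢⱼ ∂ₖ φ`. -/
def hessCoord {n : ℕ} (G : Model n → Matrix (Fin n) (Fin n) ℝ) (φ : Model n → ℝ)
    (z : Model n) (i j : Fin n) : ℝ :=
  pd i (pd j φ) z - ∑ k, christoffel G k i j z * pd k φ z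

/-- The Laplace-Beltrami operator, as the metric trace of the Hessian:
`g^{ij} (∂ᵢ∂ⱼ φ - Γᵏᵢⱼ ∂ₖ φ)`. -/
def laplaceCoord {n : ℕ} (G : Model n → Matrix (Fin n) (Fin n) ℝ) (φ : Model n → ℝ)
    (z : Model n) : ℝ :=
  ∑ i, ∑ j, (G z)⁻¹ i j * hessCoord G φ z i j

/-! ### Metrics, gradients and curvature on a manifold -/

section Manifold

variable {n : ℕ} {M : Type*} [TopologicalSpace M] [ChartedSpace (Model n) M]

/-- A bilinear form on each tangent space of `M`. -/
abbrev TwoTensor (n : ℕ) (M : Type*) [TopologicalSpace M] [ChartedSpace (Model n) M] : Type _ :=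
  ∀ x : M, TangentSpace (𝓡 n) x →L[ℝ] TangentSpace (𝓡 n) x →L[ℝ] ℝ

/-- Riemannian metrics of class `C²` on `M`. -/
abbrev Metric (n : ℕ) (M : Type*) [TopologicalSpace M] [ChartedSpace (Model n) M]
    [IsManifold (𝓡 n) ∞ M] : Type _ :=
  haveI : IsManifold (𝓡 n) 1 M := IsManifold.of_le (n := ∞) (by exact_mod_cast le_top)
  Bundle.ContMDiffRiemannianMetric (𝓡 n) 2 (Model n)
    (fun x : M => TangentSpace (𝓡 n) x)

variable [IsManifold (𝓡 n) ∞ M]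

/-- The differential of a real function, as a linear form on the tangent space. -/
def dform (w : M → ℝ) (x : M) : TangentSpace (𝓡 n) x →L[ℝ] ℝ :=
  mfderiv (𝓡 n) 𝓘(ℝ, ℝ) w x

/-- Every linear form on a tangent space is represented by a unique vector. -/
theorem existsUnique_riesz (g : Metric n M) (x : M) (a : TangentSpace (𝓡 n) x →L[ℝ] ℝ) :
    ∃! X : TangentSpace (𝓡 n) x, ∀ Y : TangentSpace (𝓡 n) x, g.inner x X Y = a Y := by
  have : FiniteDimensional ℝ (TangentSpace (𝓡 n) x) :=
    inferInstanceAs (FiniteDimensional ℝ (Model n))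
  let L : TangentSpace (𝓡 n) x →ₗ[ℝ] Module.Dual ℝ (TangentSpace (𝓡 n) x) :=
    { toFun := fun X => (g.inner x X : TangentSpace (𝓡 n) x →ₗ[ℝ] ℝ)
      map_add' := fun X Y => by ext Z; simp
      map_smul' := fun c X => by ext Z; simp }
  have hL : ∀ X Y, L X Y = g.inner x X Y := fun _ _ => rfl
  have hinj : Function.Injective L := by
    rw [← LinearMap.ker_eq_bot, LinearMap.ker_eq_bot']
    intro X hX
    by_contra hne
    have h := g.pos x X hne
    rw [← hL, hX] at h
    simp at h
  have hsurj : Function.Surjective L :=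
    (LinearMap.injective_iff_surjective_of_finrank_eq_finrank
      (Subspace.dual_finrank_eq).symm).1 hinj
  obtain ⟨X, hX⟩ := hsurj (a : TangentSpace (𝓡 n) x →ₗ[ℝ] ℝ)
  refine ⟨X, fun Y => ?_, fun Z hZ => hinj ?_⟩
  · rw [← hL, hX]; rfl
  · rw [hX]; ext Y; rw [hL, hZ]; rfl

/-- The gradient `∇w` at `x`: the vector with `g(∇w, Y) = dw(Y)` for every tangent vector `Y`. -/
def grad (g : Metric n M) (w : M → ℝ) (x : M) : TangentSpace (𝓡 n) x :=
  Classical.choose (existsUnique_riesz g x (dform w x)).exists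

/-- The inner product `⟨∇w₁, ∇w₂⟩` at `x`. -/
def gradInner (g : Metric n M) (w₁ w₂ : M → ℝ) (x : M) : ℝ :=
  g.inner x (grad g w₁ x) (grad g w₂ x)

/-- The coordinate vector field `∂/∂xᵢ` of the chart `e`, at the point with coordinates `z`. -/
def frame (e : OpenPartialHomeomorph M (Model n)) (i : Fin n) (z : Model n) :
    TangentSpace (𝓡 n) (e.symm z) :=
  mfderiv (𝓡 n) (𝓡 n) e.symm z (EuclideanSpace.single i 1 : Model n)

/-- The components `g_{ij}` of the metric in the chart `e`. -/
def components (g : Metric n M) (e : OpenPartialHomeomorph M (Model n)) (z : Model n) :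
    Matrix (Fin n) (Fin n) ℝ :=
  Matrix.of fun i j => g.inner (e.symm z) (frame e i z) (frame e j z)

/-- The coordinates of a tangent vector in the chart `e`. -/
def coords (e : OpenPartialHomeomorph M (Model n)) (x : M) (X : TangentSpace (𝓡 n) x) :
    Model n :=
  mfderiv (𝓡 n) (𝓡 n) e x X

/-- The Ricci tensor `Ric(g)(X, Y)` at `x`, computed in the chart `e` around `x`. -/
def ricci (g : Metric n M) (e : OpenPartialHomeomorph M (Model n)) (x : M)
    (X Y : TangentSpace (𝓡 n) x) : ℝ :=
  ∑ i, ∑ j, ricciCoord (components g e) (e x) i j * coords e x X i * coords e x Y j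

/-- The Hessian `∇∇w(X, Y)` at `x`, computed in the chart `e` around `x`. -/
def hess (g : Metric n M) (e : OpenPartialHomeomorph M (Model n)) (w : M → ℝ) (x : M)
    (X Y : TangentSpace (𝓡 n) x) : ℝ :=
  ∑ i, ∑ j, hessCoord (components g e) (w ∘ e.symm) (e x) i j * coords e x X i * coords e x Y j

/-- The Bakry-Émery `m`-Ricci tensor `Ric(g) + ∇∇f - (∇f ⊗ ∇f) / (m - n)` at `x`, computed in the
chart `e` around `x`. (When `m = n` it is used only for spatially constant `f`, and is `Ric(g)`.) -/
def bakryEmery (m : ℝ) (g : Metric n M) (f : M → ℝ) (e : OpenPartialHomeomorph M (Model n))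
    (x : M) (X Y : TangentSpace (𝓡 n) x) : ℝ :=
  ricci g e x X Y + hess g e f x X Y - dform f x X * dform f x Y / (m - n)

/-- The `f`-Laplacian `Δ_f w = Δ w - ⟨∇f, ∇w⟩` at `x`, computed in the chart `e` around `x`. -/
def fLaplacian (g : Metric n M) (f : M → ℝ) (e : OpenPartialHomeomorph M (Model n))
    (w : M → ℝ) (x : M) : ℝ :=
  laplaceCoord (components g e) (w ∘ e.symm) (e x) - gradInner g f w x

/-! ### Evolving metrics, the porous medium equation, and the super flow inequality -/

/-- The metrics `g t` form a family of class `C²` in space-time on `M × [0, T]`. -/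
def IsC2MetricFamily (T : ℝ) (g : ℝ → Metric n M) : Prop :=
  haveI : IsManifold (𝓡 n) 1 M := IsManifold.of_le (n := ∞) (by exact_mod_cast le_top)
  ContMDiffOn ((𝓡 n).prod 𝓘(ℝ, ℝ)) ((𝓡 n).prod 𝓘(ℝ, Model n →L[ℝ] Model n →L[ℝ] ℝ)) 2
    (fun q : M × ℝ => Bundle.TotalSpace.mk' (Model n →L[ℝ] Model n →L[ℝ] ℝ)
      (E := fun x : M => TangentSpace (𝓡 n) x →L[ℝ] TangentSpace (𝓡 n) x →L[ℝ] ℝ)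
      q.1 ((g q.2).inner q.1))
    (Set.univ ×ˢ Set.Icc 0 T)

variable (n) in
/-- A time dependent function (time first) is of class `C^r` in space-time on `M × [0, T]`. -/
def IsCrOnSpaceTime (r : WithTop ℕ∞) (T : ℝ) (w : ℝ → M → ℝ) : Prop :=
  ContMDiffOn ((𝓡 n).prod 𝓘(ℝ, ℝ)) 𝓘(ℝ, ℝ) r (fun q : M × ℝ => w q.2 q.1)
    (Set.univ ×ˢ Set.Icc 0 T)

/-- `u` is a positive smooth solution on `M × [0, T]` of
`∂ₜu - Δ_f uᵖ = 𝒩(t, x, u)`, where the metric and the potential defining `Δ_f` at time `t` are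
`g t` and `f t`. The equation is written in the local coordinates of each chart of the atlas. -/
structure IsPositiveSmoothSolution (T p : ℝ) (g : ℝ → Metric n M) (f : ℝ → M → ℝ)
    (nl : ℝ → M → ℝ → ℝ) (u : ℝ → M → ℝ) : Prop where
  smooth : IsCrOnSpaceTime n ∞ T u
  pos : ∀ t ∈ Set.Icc 0 T, ∀ x, 0 < u t x
  equation : ∀ t ∈ Set.Ioc 0 T, ∀ e ∈ atlas (Model n) M, ∀ x ∈ e.source,
    derivWithin (fun s => u s x) (Set.Icc 0 T) t
      - fLaplacian (g t) (f t) e (fun y => u t y ^ p) x = nl t x (u t x)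

/-- The super flow inequality `½ ∂ₜg + (p - 1) v Ric^m_f(g) ≥ -k g` on `M × (0, T]`, as an
inequality between quadratic forms on tangent spaces. -/
def SuperFlow (T p m k : ℝ) (g : ℝ → Metric n M) (f v : ℝ → M → ℝ) : Prop :=
  ∀ t ∈ Set.Ioc 0 T, ∀ e ∈ atlas (Model n) M, ∀ x ∈ e.source, ∀ X : TangentSpace (𝓡 n) x,
    -k * (g t).inner x X X ≤
      (1 / 2) * derivWithin (fun s => (g s).inner x X X) (Set.Icc 0 T) t
        + (p - 1) * v t x * bakryEmery m (g t) (f t) e x X X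

/-- The pressure `v = p u^{p-1} / (p - 1)`. -/
def pressure (p : ℝ) (u : ℝ → M → ℝ) (t : ℝ) (x : M) : ℝ :=
  p * u t x ^ (p - 1) / (p - 1)

/-- `Σ(t, x, v) = p [(p-1)v/p]^{(p-2)/(p-1)} 𝒩(t, x, [(p-1)v/p]^{1/(p-1)})`. -/
def sigma (p : ℝ) (nl : ℝ → M → ℝ → ℝ) (t : ℝ) (x : M) (v : ℝ) : ℝ :=
  p * ((p - 1) * v / p) ^ ((p - 2) / (p - 1)) *
    nl t x (((p - 1) * v / p) ^ (1 / (p - 1)))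

end Manifold

end NPME

end

open NPME

/-! The proof is a maximum principle for F = v^a (ψ|∇v|² + (p-1)v), where a = 1/(p-1) and ψ =
p²t/(1+2kt). Since ψ(0) = 0 and a + 1 = p/(p-1), at time 0 the function F is (p-1)v^{p/(p-1)}, and
the estimate says exactly that F never exceeds its initial maximum. It suffices that ∂ₜF ≤ 0 at
every spatial maximum of F(·,t) with t > 0 (`hamiltonQuantity_time_deriv_nonpos`); compactness and
the perturbation F - εt do the rest.

Multiplied by p u^{p-2}, the equation becomes ∂ₜv = (p-1)vΔ_f v + |∇v|² + Σ (`pressure_equation`).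
Put q = |∇v|², y = q/v and R = ψq + (p-1)v. The time derivative of q contains 2(p-1)v⟨∇v,∇Δ_f v⟩ and
-∂ₜg(∇v,∇v). Bochner's formula (`bochner_drift`) trades the first term for (p-1)vΔ_f q, leaving
-2(p-1)v(|∇∇v|² + (Ric + ∇∇f)(∇v,∇v)). The super flow inequality, tested on ∇v, absorbs the
curvature and ∂ₜg at the cost of 2kq and a term in ⟨∇f,∇v⟩²/(m-n).

At the maximum, ∇R = -(aR/v)∇v and ΔF ≤ 0. The Hessian is estimated by expanding |∇∇v + αg + β
dv⊗dv|² ≥ 0 (`hess_lower_bound`) with α = -y/2 and β = pa/(2v). Completing the square in ⟨∇f,∇v⟩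
replaces the dimension n by m, and the remainder is (p-1)vy²(m-1+a²)/2. The bound on p says m-1 ≤
a², so this is at most avy². The first-order condition then reduces the upper bound, up to the
factor v^{a-1}, to vq(ψ' + 2kψ - p²) + pvΣ + 2vψ⟨∇v,Σ_x⟩ + ψq(2vΣ_v + aΣ), in which every term is
nonpositive (`evolution_nonpos`).

The geometry is carried out in charts. The Ricci identity and Bochner's formula rest on ∇g = 0 and
on the symmetry of second partial derivatives; they use two derivatives of g and three of the
function, which is all that a C² metric allows. -/

noncomputable section
namespace NPME

/-! ### Rules for partial derivatives -/

section PartialDerivatives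

variable {n : ℕ} {F H : Model n → ℝ} {z : Model n} {U : Set (Model n)}

theorem pd_add (i : Fin n) (hF : DifferentiableAt ℝ F z) (hH : DifferentiableAt ℝ H z) :
    pd i (fun y => F y + H y) z = pd i F z + pd i H z := by
  simp only [pd]; rw [fderiv_fun_add hF hH]; rfl

theorem pd_sub (i : Fin n) (hF : DifferentiableAt ℝ F z) (hH : DifferentiableAt ℝ H z) :
    pd i (fun y => F y - H y) z = pd i F z - pd i H z := by
  simp only [pd]; rw [fderiv_fun_sub hF hH]; rfl

theorem pd_mul (i : Fin n) (hF : DifferentiableAt ℝ F z) (hH : DifferentiableAt ℝ H z) :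
    pd i (fun y => F y * H y) z = pd i F z * H z + F z * pd i H z := by
  simp only [pd]; rw [fderiv_fun_mul hF hH]
  simp only [add_apply, smul_apply, smul_eq_mul]; ring

theorem pd_const_mul (i : Fin n) (c : ℝ) (hF : DifferentiableAt ℝ F z) :
    pd i (fun y => c * F y) z = c * pd i F z := by
  simp only [pd]; rw [fderiv_const_mul hF]; rfl

theorem pd_const (i : Fin n) (c : ℝ) (z : Model n) : pd i (fun _ => c) z = 0 := by
  simp [pd]

theorem pd_sum {ι : Type*} (s : Finset ι) {A : ι → Model n → ℝ} (i : Fin n)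
    (hA : ∀ j ∈ s, DifferentiableAt ℝ (A j) z) :
    pd i (fun y => ∑ j ∈ s, A j y) z = ∑ j ∈ s, pd i (A j) z := by
  simp only [pd]; rw [fderiv_fun_sum hA]; simp

theorem pd_comp (i : Fin n) {θ : ℝ → ℝ} {θ' : ℝ} (hθ : HasDerivAt θ θ' (F z))
    (hF : DifferentiableAt ℝ F z) : pd i (fun y => θ (F y)) z = θ' * pd i F z := by
  have h := hθ.comp_hasFDerivAt z hF.hasFDerivAt
  simp only [pd]
  rw [show (fun y => θ (F y)) = θ ∘ F from rfl, h.fderiv]; simp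

theorem pd_congr (hU : IsOpen U) (hz : z ∈ U) (h : ∀ y ∈ U, F y = H y) (i : Fin n) :
    pd i F z = pd i H z := by
  have : F =ᶠ[nhds z] H := Filter.eventually_of_mem (hU.mem_nhds hz) h
  simp only [pd, this.fderiv_eq]

theorem contDiffOn_pd (hU : IsOpen U) {k l : WithTop ℕ∞} (hF : ContDiffOn ℝ k F U)
    (hl : l + 1 ≤ k) (i : Fin n) : ContDiffOn ℝ l (pd i F) U :=
  (hF.fderiv_of_isOpen hU hl).clm_apply contDiffOn_const

theorem differentiableAt_of_contDiffOn (hU : IsOpen U) {k : WithTop ℕ∞}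
    (hF : ContDiffOn ℝ k F U) (hk : 1 ≤ k) (hz : z ∈ U) : DifferentiableAt ℝ F z :=
  (hF.contDiffAt (hU.mem_nhds hz)).differentiableAt (by rintro rfl; simp at hk)

theorem pd_comm (hU : IsOpen U) (hF : ContDiffOn ℝ 2 F U) (hz : z ∈ U) (i j : Fin n) :
    pd i (pd j F) z = pd j (pd i F) z := by
  have hs : IsSymmSndFDerivAt ℝ F z :=
    (hF.contDiffAt (hU.mem_nhds hz)).isSymmSndFDerivAt (by simp)
  have hd : DifferentiableAt ℝ (fderiv ℝ F) z :=
    ((hF.fderiv_of_isOpen (m := 1) hU (by norm_num)).contDiffAt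
      (hU.mem_nhds hz)).differentiableAt (by simp)
  have key : ∀ a b : Fin n, pd a (pd b F) z =
      fderiv ℝ (fderiv ℝ F) z (EuclideanSpace.single a 1) (EuclideanSpace.single b 1) := by
    intro a b
    unfold pd
    rw [fderiv_clm_apply hd (differentiableAt_const _)]
    simp
  rw [key, key, hs]

end PartialDerivatives

/-! ### Smoothness of matrix inverses -/

section MatrixInverse

variable {E : Type*} [NormedAddCommGroup E] [NormedSpace ℝ E] {n : ℕ} {k : WithTop ℕ∞}
  {G : E → Matrix (Fin n) (Fin n) ℝ} {s : Set E}

theorem contDiffOn_det (hG : ∀ i j, ContDiffOn ℝ k (fun z => G z i j) s) :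
    ContDiffOn ℝ k (fun z => (G z).det) s := by
  simp only [Matrix.det_apply]
  refine ContDiffOn.sum fun σ _ => ContDiffOn.const_smul _ ?_
  exact contDiffOn_prod fun i _ => hG _ _

/-- By Cramer's rule an entry of the inverse is a cofactor over the determinant, and both are
polynomial in the entries. -/
theorem contDiffOn_inv_entry (hG : ∀ i j, ContDiffOn ℝ k (fun z => G z i j) s)
    (hdet : ∀ z ∈ s, (G z).det ≠ 0) (i j : Fin n) :
    ContDiffOn ℝ k (fun z => (G z)⁻¹ i j) s := by
  simp only [Matrix.inv_def, Ring.inverse_eq_inv', Matrix.smul_apply, smul_eq_mul,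
    Matrix.adjugate_apply]
  refine ((contDiffOn_det hG).inv hdet).mul (contDiffOn_det fun a b => ?_)
  by_cases h : a = j
  · subst h; simp only [Matrix.updateRow_self]; exact contDiffOn_const
  · simp only [Matrix.updateRow_ne h]; exact hG a b

end MatrixInverse

/-! ### Riemannian calculus in coordinates -/

section Coordinates

variable {n : ℕ}

/-- `G` is the component matrix of a Riemannian metric of class `C²` on the open set `U`. -/
structure IsMetricOn (U : Set (Model n)) (G : Model n → Matrix (Fin n) (Fin n) ℝ) : Prop where
  isOpen : IsOpen U
  contDiffOn : ∀ i j, ContDiffOn ℝ 2 (fun z => G z i j) U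
  posDef : ∀ z ∈ U, (G z).PosDef

/-- The components of the gradient of `φ`. -/
def gradCoord (G : Model n → Matrix (Fin n) (Fin n) ℝ) (φ : Model n → ℝ) (i : Fin n)
    (z : Model n) : ℝ :=
  ∑ j, (G z)⁻¹ i j * pd j φ z

/-- The inner product of the gradients of `φ` and `χ`. -/
def innerCoord (G : Model n → Matrix (Fin n) (Fin n) ℝ) (φ χ : Model n → ℝ) (z : Model n) : ℝ :=
  ∑ i, pd i φ z * gradCoord G χ i z

/-- The covariant derivative `∇ₖ Aᵢₗ` of the Hessian `A` of `φ`. -/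
def covHess (G : Model n → Matrix (Fin n) (Fin n) ℝ) (φ : Model n → ℝ) (z : Model n)
    (k i l : Fin n) : ℝ :=
  pd k (fun y => hessCoord G φ y i l) z - ∑ m, christoffel G m k i z * hessCoord G φ z m l
    - ∑ m, christoffel G m k l z * hessCoord G φ z i m

/-- The curvature `Kᵐₖⱼₗ = ∂ⱼ Γᵐₖₗ - ∂ₗ Γᵐₖⱼ + Γʳₖₗ Γᵐᵣⱼ - Γʳₖⱼ Γᵐᵣₗ`. -/
def curvCoord (G : Model n → Matrix (Fin n) (Fin n) ℝ) (z : Model n) (m k j l : Fin n) : ℝ :=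
  pd j (christoffel G m k l) z - pd l (christoffel G m k j) z
    + ∑ r, (christoffel G r k l z * christoffel G m r j z
      - christoffel G r k j z * christoffel G m r l z)

variable {U : Set (Model n)} {G : Model n → Matrix (Fin n) (Fin n) ℝ} {φ χ : Model n → ℝ}
  {z : Model n}

namespace IsMetricOn

theorem det_ne_zero (hG : IsMetricOn U G) : ∀ z ∈ U, (G z).det ≠ 0 :=
  fun z hz => (hG.posDef z hz).det_pos.ne'

theorem symm (hG : IsMetricOn U G) (hz : z ∈ U) (i j : Fin n) : G z i j = G z j i := by
  have := (hG.posDef z hz).isHermitian.apply i j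
  simpa using this.symm

theorem inv_symm (hG : IsMetricOn U G) (hz : z ∈ U) (i j : Fin n) :
    (G z)⁻¹ i j = (G z)⁻¹ j i := by
  have := (hG.posDef z hz).inv.isHermitian.apply i j
  simpa using this.symm

theorem contDiffOn_inv (hG : IsMetricOn U G) (i j : Fin n) :
    ContDiffOn ℝ 2 (fun z => (G z)⁻¹ i j) U :=
  contDiffOn_inv_entry hG.contDiffOn hG.det_ne_zero i j

theorem sum_mul_inv (hG : IsMetricOn U G) (hz : z ∈ U) (X : Fin n → ℝ) (i : Fin n) :
    ∑ k, G z i k * ∑ j, (G z)⁻¹ k j * X j = X i := by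
  have h := Matrix.mul_nonsing_inv (G z) (hG.det_ne_zero z hz).isUnit
  have := congrFun (Matrix.mulVec_mulVec X (G z) (G z)⁻¹) i
  rw [h, Matrix.one_mulVec] at this
  simpa [Matrix.mulVec, dotProduct] using this

theorem sum_inv_mul (hG : IsMetricOn U G) (hz : z ∈ U) (X : Fin n → ℝ) (i : Fin n) :
    ∑ k, (G z)⁻¹ i k * ∑ j, G z k j * X j = X i := by
  have h := Matrix.nonsing_inv_mul (G z) (hG.det_ne_zero z hz).isUnit
  have := congrFun (Matrix.mulVec_mulVec X (G z)⁻¹ (G z)) i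
  rw [h, Matrix.one_mulVec] at this
  simpa [Matrix.mulVec, dotProduct] using this

theorem contDiffOn_christoffel (hG : IsMetricOn U G) (k i j : Fin n) :
    ContDiffOn ℝ 1 (christoffel G k i j) U := by
  have h : ∀ a b c, ContDiffOn ℝ 1 (pd a (fun y => G y b c)) U := fun a b c =>
    contDiffOn_pd hG.isOpen (hG.contDiffOn b c) (by norm_num) a
  refine contDiffOn_const.mul (ContDiffOn.sum fun l _ => ?_)
  exact ((hG.contDiffOn_inv k l).of_le (by norm_num)).mul (((h _ _ _).add (h _ _ _)).sub (h _ _ _))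

theorem christoffel_symm (hG : IsMetricOn U G) (hz : z ∈ U) (k i j : Fin n) :
    christoffel G k i j z = christoffel G k j i z := by
  unfold christoffel
  congr 1
  refine Finset.sum_congr rfl fun l _ => ?_
  rw [pd_congr hG.isOpen hz (fun y hy => hG.symm hy i j) l]
  ring

theorem sum_mul_christoffel (hG : IsMetricOn U G) (hz : z ∈ U) (l i j : Fin n) :
    ∑ k, G z l k * christoffel G k i j z =
      (1 / 2) * (pd i (fun y => G y j l) z + pd j (fun y => G y i l) z
        - pd l (fun y => G y i j) z) := by
  have h := hG.sum_mul_inv hz (fun l => pd i (fun y => G y j l) z + pd j (fun y => G y i l) z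
        - pd l (fun y => G y i j) z) l
  rw [← h, Finset.mul_sum]
  refine Finset.sum_congr rfl fun k _ => ?_
  unfold christoffel; ring

/-- Metric compatibility of the Levi-Civita connection. -/
theorem pd_metric (hG : IsMetricOn U G) (hz : z ∈ U) (l i k : Fin n) :
    pd l (fun y => G y i k) z =
      ∑ m, G z i m * christoffel G m k l z + ∑ m, G z k m * christoffel G m i l z := by
  rw [hG.sum_mul_christoffel hz, hG.sum_mul_christoffel hz,
    pd_congr hG.isOpen hz (fun y hy => hG.symm hy k i) l,
    pd_congr hG.isOpen hz (fun y hy => hG.symm hy l i) k,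
    pd_congr hG.isOpen hz (fun y hy => hG.symm hy l k) i]
  ring

theorem differentiableAt_metric (hG : IsMetricOn U G) (hz : z ∈ U) (i k : Fin n) :
    DifferentiableAt ℝ (fun y => G y i k) z :=
  differentiableAt_of_contDiffOn hG.isOpen (hG.contDiffOn i k) (by norm_num) hz

theorem differentiableAt_inv (hG : IsMetricOn U G) (hz : z ∈ U) (i k : Fin n) :
    DifferentiableAt ℝ (fun y => (G y)⁻¹ i k) z :=
  differentiableAt_of_contDiffOn hG.isOpen (hG.contDiffOn_inv i k) (by norm_num) hz

theorem differentiableAt_christoffel (hG : IsMetricOn U G) (hz : z ∈ U) (k i j : Fin n) :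
    DifferentiableAt ℝ (christoffel G k i j) z :=
  differentiableAt_of_contDiffOn hG.isOpen (hG.contDiffOn_christoffel k i j) le_rfl hz

/-- The derivative of a vector field obtained from a one-form by raising the index. -/
theorem pd_of_sum_mul_eq (hG : IsMetricOn U G) (hz : z ∈ U) {X a : Fin n → Model n → ℝ}
    (hXa : ∀ y ∈ U, ∀ i, ∑ k, G y i k * X k y = a i y)
    (hX : ∀ i, DifferentiableAt ℝ (X i) z) (l m : Fin n) :
    pd l (X m) z = ∑ i, (G z)⁻¹ m i * (pd l (a i) z - ∑ r, christoffel G r i l z * a r z)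
      - ∑ k, christoffel G m k l z * X k z := by
  have hd : ∀ i, pd l (a i) z =
      ∑ k, (pd l (fun y => G y i k) z * X k z + G z i k * pd l (X k) z) := by
    intro i
    rw [← pd_congr hG.isOpen hz (fun y hy => hXa y hy i) l,
      pd_sum _ _ (fun k _ => (hG.differentiableAt_metric hz i k).fun_mul (hX k))]
    exact Finset.sum_congr rfl fun k _ => pd_mul l (hG.differentiableAt_metric hz i k) (hX k)
  -- Expanding ∂ₗg by metric compatibility, one Christoffel term completes ∂ₗX to ∇ₗX and the other
  -- completes ∂ₗa to ∇ₗa. The result is ∇ₗX with its index lowered; it remains to apply g⁻¹.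
  have key : ∀ i, ∑ j, G z i j * (pd l (X j) z + ∑ k, christoffel G j k l z * X k z) =
      pd l (a i) z - ∑ r, christoffel G r i l z * a r z := by
    intro i
    have h1 : ∑ j, G z i j * ∑ k, christoffel G j k l z * X k z =
        ∑ k, (∑ j, G z i j * christoffel G j k l z) * X k z := by
      simp only [Finset.mul_sum, Finset.sum_mul]
      rw [Finset.sum_comm]
      exact Finset.sum_congr rfl fun _ _ => Finset.sum_congr rfl fun _ _ => by ring
    have h2 : ∑ r, christoffel G r i l z * a r z =
        ∑ k, (∑ r, G z k r * christoffel G r i l z) * X k z := by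
      simp only [← hXa z hz, Finset.mul_sum, Finset.sum_mul]
      rw [Finset.sum_comm]
      exact Finset.sum_congr rfl fun k _ => Finset.sum_congr rfl fun r _ => by
        rw [hG.symm hz k r]; ring
    simp only [mul_add, Finset.sum_add_distrib, h1]
    rw [h2, hd i]
    simp only [hG.pd_metric hz, add_mul, Finset.sum_add_distrib]
    ring
  have := hG.sum_inv_mul hz
    (fun j => pd l (X j) z + ∑ k, christoffel G j k l z * X k z) m
  simp only [key] at this
  linarith

theorem sum_mul_gradCoord (hG : IsMetricOn U G) (hz : z ∈ U) (φ : Model n → ℝ) (i : Fin n) :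
    ∑ k, G z i k * gradCoord G φ k z = pd i φ z :=
  hG.sum_mul_inv hz (fun j => pd j φ z) i

theorem contDiffOn_gradCoord (hG : IsMetricOn U G) {k l : WithTop ℕ∞} (hφ : ContDiffOn ℝ k φ U)
    (hl : l + 1 ≤ k) (hl' : l ≤ 2) (i : Fin n) : ContDiffOn ℝ l (gradCoord G φ i) U :=
  ContDiffOn.sum fun j _ => ((hG.contDiffOn_inv i j).of_le hl').mul
    (contDiffOn_pd hG.isOpen hφ hl j)

theorem contDiffOn_innerCoord (hG : IsMetricOn U G) {k l : WithTop ℕ∞} (hφ : ContDiffOn ℝ k φ U)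
    (hχ : ContDiffOn ℝ k χ U)
    (hl : l + 1 ≤ k) (hl' : l ≤ 2) : ContDiffOn ℝ l (innerCoord G φ χ) U :=
  ContDiffOn.sum fun i _ => (contDiffOn_pd hG.isOpen hφ hl i).mul
    (hG.contDiffOn_gradCoord hχ hl hl' i)

theorem contDiffOn_hessCoord (hG : IsMetricOn U G) {k l : WithTop ℕ∞} (hφ : ContDiffOn ℝ k φ U)
    (hl : l + 2 ≤ k) (hl' : l ≤ 1) (i j : Fin n) :
    ContDiffOn ℝ l (fun y => hessCoord G φ y i j) U := by
  have h1 : l + 1 + 1 ≤ k := by rw [add_assoc, one_add_one_eq_two]; exact hl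
  have h2 : ∀ j, ContDiffOn ℝ (l + 1) (pd j φ) U := contDiffOn_pd hG.isOpen hφ h1
  refine (contDiffOn_pd hG.isOpen (h2 j) le_rfl i).sub (ContDiffOn.sum fun m _ => ?_)
  exact ((hG.contDiffOn_christoffel m i j).of_le hl').mul ((h2 m).of_le le_self_add)

theorem hessCoord_symm (hG : IsMetricOn U G) (hφ : ContDiffOn ℝ 2 φ U) (hz : z ∈ U)
    (i j : Fin n) : hessCoord G φ z i j = hessCoord G φ z j i := by
  unfold hessCoord
  rw [pd_comm hG.isOpen hφ hz i j]
  congr 1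
  exact Finset.sum_congr rfl fun k _ => by rw [hG.christoffel_symm hz]

/-- Raising an index commutes with ∇, so the covariant derivative of the gradient is the Hessian
with one index raised. -/
theorem pd_gradCoord (hG : IsMetricOn U G) (hφ : ContDiffOn ℝ 2 φ U) (hz : z ∈ U)
    (l m : Fin n) :
    pd l (gradCoord G φ m) z = ∑ i, (G z)⁻¹ m i * hessCoord G φ z l i
      - ∑ k, christoffel G m k l z * gradCoord G φ k z := by
  rw [hG.pd_of_sum_mul_eq hz (X := gradCoord G φ) (a := fun i => pd i φ)
    (fun y hy i => hG.sum_mul_gradCoord hy φ i)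
    (fun i => differentiableAt_of_contDiffOn hG.isOpen
      (hG.contDiffOn_gradCoord (l := 1) hφ (by norm_num) (by norm_num) i) le_rfl hz)]
  congr 1
  refine Finset.sum_congr rfl fun i _ => ?_
  unfold hessCoord
  simp only [hG.christoffel_symm hz _ i l]

/-- This is ∇g⁻¹ = 0 written out. Column j of g⁻¹ is the vector field obtained by raising the index
of the constant one-form dxⱼ, so the rule for raised one-forms applies. -/
theorem pd_inv (hG : IsMetricOn U G) (hz : z ∈ U) (l i j : Fin n) :
    pd l (fun y => (G y)⁻¹ i j) z = - ∑ k, (G z)⁻¹ i k * christoffel G j k l z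
      - ∑ k, christoffel G i k l z * (G z)⁻¹ k j := by
  rw [hG.pd_of_sum_mul_eq hz (X := fun k y => (G y)⁻¹ k j)
    (a := fun i _ => (1 : Matrix (Fin n) (Fin n) ℝ) i j) (fun y hy i => ?_)
    (fun i => hG.differentiableAt_inv hz i j)]
  · simp [pd_const, Matrix.one_apply]
  · rw [← Matrix.mul_nonsing_inv (G y) (hG.det_ne_zero y hy).isUnit, Matrix.mul_apply]

end IsMetricOn
end Coordinates

/-! ### Third covariant derivatives, the Ricci identity and Bochner's formula. -/

section Coordinates

variable {n : ℕ} {U : Set (Model n)} {G : Model n → Matrix (Fin n) (Fin n) ℝ}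
  {φ χ : Model n → ℝ} {z : Model n}

namespace IsMetricOn

theorem pd_pd_eq (hG : IsMetricOn U G) (hz : z ∈ U) (φ : Model n → ℝ) (l i : Fin n) :
    pd l (pd i φ) z = hessCoord G φ z l i + ∑ k, christoffel G k i l z * pd k φ z := by
  unfold hessCoord
  simp only [hG.christoffel_symm hz _ i l, sub_add_cancel]

theorem innerCoord_comm (hG : IsMetricOn U G) (hz : z ∈ U) (φ χ : Model n → ℝ) :
    innerCoord G φ χ z = innerCoord G χ φ z := by
  simp only [innerCoord, gradCoord, Finset.mul_sum]
  rw [Finset.sum_comm]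
  refine Finset.sum_congr rfl fun i _ => Finset.sum_congr rfl fun j _ => ?_
  rw [hG.inv_symm hz i j]; ring

theorem sum_pd_mul_inv (hG : IsMetricOn U G) (hz : z ∈ U) (φ : Model n → ℝ) (X : Fin n → ℝ) :
    ∑ i, pd i φ z * ∑ j, (G z)⁻¹ i j * X j = ∑ j, X j * gradCoord G φ j z := by
  simp only [gradCoord, Finset.mul_sum]
  rw [Finset.sum_comm]
  refine Finset.sum_congr rfl fun i _ => Finset.sum_congr rfl fun j _ => ?_
  rw [hG.inv_symm hz i j]; ring

/-- No Christoffel symbols survive because the connection is metric: those completing ∂∂φ to the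
Hessian cancel those from differentiating the gradient of χ. -/
theorem pd_innerCoord (hG : IsMetricOn U G) (hφ : ContDiffOn ℝ 2 φ U) (hχ : ContDiffOn ℝ 2 χ U)
    (hz : z ∈ U) (l : Fin n) :
    pd l (innerCoord G φ χ) z = ∑ i, hessCoord G φ z l i * gradCoord G χ i z
      + ∑ i, hessCoord G χ z l i * gradCoord G φ i z := by
  have d1 : ∀ i, DifferentiableAt ℝ (pd i φ) z := fun i =>
    differentiableAt_of_contDiffOn hG.isOpen
      (contDiffOn_pd (l := 1) hG.isOpen hφ (by norm_num) i) le_rfl hz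
  have d2 : ∀ i, DifferentiableAt ℝ (gradCoord G χ i) z := fun i =>
    differentiableAt_of_contDiffOn hG.isOpen
      (hG.contDiffOn_gradCoord (l := 1) hχ (by norm_num) (by norm_num) i) le_rfl hz
  unfold innerCoord
  rw [pd_sum _ _ (fun k _ => (d1 k).fun_mul (d2 k))]
  simp only [pd_mul _ (d1 _) (d2 _), hG.pd_gradCoord hχ hz, hG.pd_pd_eq hz φ, mul_sub, add_mul,
    Finset.sum_add_distrib, Finset.sum_sub_distrib, hG.sum_pd_mul_inv hz]
  have : ∑ i, (∑ k, christoffel G k i l z * pd k φ z) * gradCoord G χ i z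
      = ∑ i, pd i φ z * ∑ k, christoffel G i k l z * gradCoord G χ k z := by
    simp only [Finset.mul_sum, Finset.sum_mul]
    rw [Finset.sum_comm]
    exact Finset.sum_congr rfl fun i _ => Finset.sum_congr rfl fun j _ => by ring
  rw [this]; ring

theorem differentiableAt_hessCoord (hG : IsMetricOn U G) (hφ : ContDiffOn ℝ 3 φ U) (hz : z ∈ U)
    (i j : Fin n) : DifferentiableAt ℝ (fun y => hessCoord G φ y i j) z :=
  differentiableAt_of_contDiffOn hG.isOpen
    (hG.contDiffOn_hessCoord (l := 1) hφ (by norm_num) le_rfl i j) le_rfl hz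

/-- The metric trace commutes with ∇ because ∇g⁻¹ = 0. The Christoffel terms in the derivative of
g⁻¹ are, after relabelling, those in `covHess`. -/
theorem pd_laplaceCoord (hG : IsMetricOn U G) (hφ : ContDiffOn ℝ 3 φ U) (hz : z ∈ U)
    (j : Fin n) :
    pd j (laplaceCoord G φ) z = ∑ k, ∑ l, (G z)⁻¹ k l * covHess G φ z j k l := by
  have d1 := fun k l => (hG.differentiableAt_inv hz k l).fun_mul (hG.differentiableAt_hessCoord hφ hz k l)
  unfold laplaceCoord
  rw [pd_sum _ _ (fun k _ => DifferentiableAt.fun_sum fun l _ => d1 k l)]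
  simp only [pd_sum _ _ (fun l _ => d1 _ l),
    pd_mul _ (hG.differentiableAt_inv hz _ _) (hG.differentiableAt_hessCoord hφ hz _ _),
    hG.pd_inv hz, covHess, mul_sub, sub_mul, neg_mul, Finset.sum_add_distrib,
    Finset.sum_sub_distrib, Finset.sum_neg_distrib, Finset.mul_sum, Finset.sum_mul]
  have h1 : ∑ k, ∑ l, ∑ m, (G z)⁻¹ k m * christoffel G l m j z * hessCoord G φ z k l
      = ∑ k, ∑ l, ∑ m, (G z)⁻¹ k l * (christoffel G m j l z * hessCoord G φ z k m) := by
    refine Finset.sum_congr rfl fun k _ => ?_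
    rw [Finset.sum_comm]
    refine Finset.sum_congr rfl fun l _ => Finset.sum_congr rfl fun m _ => ?_
    rw [hG.christoffel_symm hz m l j]; ring
  have h2 : ∑ k, ∑ l, ∑ m, christoffel G k m j z * (G z)⁻¹ m l * hessCoord G φ z k l
      = ∑ k, ∑ l, ∑ m, (G z)⁻¹ k l * (christoffel G m j k z * hessCoord G φ z m l) := by
    rw [Finset.sum_congr rfl fun k _ => Finset.sum_comm, Finset.sum_comm]
    refine Finset.sum_congr rfl fun k _ => ?_
    rw [Finset.sum_comm]
    refine Finset.sum_congr rfl fun l _ => Finset.sum_congr rfl fun m _ => ?_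
    rw [hG.christoffel_symm hz m k j]; ring
  rw [h1, h2]; ring

/-- The formula ∂ₗ|∇φ|² = 2∇∇φ(∂ₗ,∇φ) is differentiated once more; the second term arises when the
derivative falls on ∇φ. -/
theorem hessCoord_innerCoord_self (hG : IsMetricOn U G) (hφ : ContDiffOn ℝ 3 φ U) (hz : z ∈ U)
    (k l : Fin n) :
    hessCoord G (innerCoord G φ φ) z k l =
      2 * ∑ i, gradCoord G φ i z * covHess G φ z k l i
      + 2 * ∑ i, hessCoord G φ z l i * ∑ m, (G z)⁻¹ i m * hessCoord G φ z k m := by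
  have hφ2 : ContDiffOn ℝ 2 φ U := hφ.of_le (by norm_num)
  have d2 : ∀ i, DifferentiableAt ℝ (gradCoord G φ i) z := fun i =>
    differentiableAt_of_contDiffOn hG.isOpen
      (hG.contDiffOn_gradCoord (l := 1) hφ2 (by norm_num) (by norm_num) i) le_rfl hz
  have d3 := fun i => (hG.differentiableAt_hessCoord hφ hz l i).fun_mul (d2 i)
  have e : ∀ y ∈ U, ∀ l, pd l (innerCoord G φ φ) y =
      2 * ∑ i, hessCoord G φ y l i * gradCoord G φ i y := fun y hy l => by
    rw [hG.pd_innerCoord hφ2 hφ2 hy]; ring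
  conv_lhs => unfold hessCoord
  rw [pd_congr hG.isOpen hz (fun y hy => e y hy l),
    pd_const_mul _ _ (DifferentiableAt.fun_sum fun i _ => d3 i), pd_sum _ _ (fun i _ => d3 i)]
  simp only [pd_mul _ (hG.differentiableAt_hessCoord hφ hz _ _) (d2 _), e z hz,
    hG.pd_gradCoord hφ2 hz, covHess, mul_sub, Finset.sum_sub_distrib, Finset.sum_add_distrib,
    Finset.mul_sum, mul_add]
  have h1 : ∑ k_1, ∑ i, 2 * (hessCoord G φ z l k_1 * (christoffel G k_1 i k z * gradCoord G φ i z))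
      = ∑ i, ∑ i_1, 2 * (gradCoord G φ i z * (christoffel G i_1 k i z * hessCoord G φ z l i_1)) := by
    rw [Finset.sum_comm]
    refine Finset.sum_congr rfl fun i _ => Finset.sum_congr rfl fun m _ => ?_
    rw [hG.christoffel_symm hz m i k]; ring
  have h2 : ∑ x, ∑ i, christoffel G x k l z * (2 * (hessCoord G φ z x i * gradCoord G φ i z))
      = ∑ i, ∑ i_1, 2 * (gradCoord G φ i z * (christoffel G i_1 k l z * hessCoord G φ z i_1 i)) := by
    rw [Finset.sum_comm]
    exact Finset.sum_congr rfl fun i _ => Finset.sum_congr rfl fun m _ => by ring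
  have h3 : ∀ i, 2 * (pd k (fun y => hessCoord G φ y l i) z * gradCoord G φ i z)
      = 2 * (gradCoord G φ i z * pd k (fun y => hessCoord G φ y l i) z) := fun i => by ring
  simp only [h1, h2, h3]; ring

/-- The Ricci identity for the third covariant derivatives of a function. -/
theorem covHess_sub_covHess (hG : IsMetricOn U G) (hφ : ContDiffOn ℝ 3 φ U) (hz : z ∈ U)
    (l j k : Fin n) :
    covHess G φ z l j k - covHess G φ z j l k = ∑ m, curvCoord G z m k j l * pd m φ z := by
  have hφ2 : ContDiffOn ℝ 2 φ U := hφ.of_le (by norm_num)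
  have hp : ∀ i, ContDiffOn ℝ 2 (pd i φ) U := contDiffOn_pd hG.isOpen hφ (by norm_num)
  have d1 : ∀ i, DifferentiableAt ℝ (pd i φ) z := fun i =>
    differentiableAt_of_contDiffOn hG.isOpen (hp i) (by norm_num) hz
  have d2 : ∀ i j, DifferentiableAt ℝ (pd i (pd j φ)) z := fun i j =>
    differentiableAt_of_contDiffOn hG.isOpen
      (contDiffOn_pd (l := 1) hG.isOpen (hp j) (by norm_num) i) le_rfl hz
  have d3 := fun m i j => (hG.differentiableAt_christoffel hz m i j).fun_mul (d1 m)
  have e : ∀ a b c, pd a (fun y => hessCoord G φ y b c) z = pd a (pd b (pd c φ)) z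
      - ∑ m, (pd a (christoffel G m b c) z * pd m φ z
        + christoffel G m b c z * pd a (pd m φ) z) := by
    intro a b c
    unfold hessCoord
    rw [pd_sub _ (d2 b c) (DifferentiableAt.fun_sum fun m _ => d3 m b c),
      pd_sum _ _ (fun m _ => d3 m b c)]
    simp only [pd_mul _ (hG.differentiableAt_christoffel hz _ _ _) (d1 _)]
  have h1 : ∀ l j, ∑ m, christoffel G m l k z * hessCoord G φ z j m
      = ∑ m, christoffel G m k l z * pd j (pd m φ) z
        - ∑ m, (∑ r, christoffel G r k l z * christoffel G m r j z) * pd m φ z := by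
    intro l j
    simp only [hessCoord, mul_sub, Finset.sum_sub_distrib, Finset.mul_sum, Finset.sum_mul]
    congr 1
    · exact Finset.sum_congr rfl fun m _ => by rw [hG.christoffel_symm hz m l k]
    · rw [Finset.sum_comm]
      refine Finset.sum_congr rfl fun i _ => Finset.sum_congr rfl fun m _ => ?_
      rw [hG.christoffel_symm hz m l k, hG.christoffel_symm hz i j m]; ring
  have h2 : ∑ m, christoffel G m l j z * hessCoord G φ z m k
      = ∑ m, christoffel G m j l z * hessCoord G φ z m k :=
    Finset.sum_congr rfl fun m _ => by rw [hG.christoffel_symm hz m l j]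
  have h3 : ∀ a b m, pd a (christoffel G m b k) z = pd a (christoffel G m k b) z := fun a b m =>
    pd_congr hG.isOpen hz (fun y hy => hG.christoffel_symm hy m b k) a
  have h4 : ∀ a b, ∑ m, (pd a (christoffel G m b k) z * pd m φ z
        + christoffel G m b k z * pd a (pd m φ) z) =
      ∑ m, pd a (christoffel G m k b) z * pd m φ z
        + ∑ m, christoffel G m k b z * pd a (pd m φ) z := by
    intro a b
    rw [← Finset.sum_add_distrib]
    exact Finset.sum_congr rfl fun m _ => by rw [h3, hG.christoffel_symm hz m b k]
  unfold covHess
  rw [e, e, pd_comm hG.isOpen (hp k) hz l j, h1, h1, h2, h4, h4]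
  simp only [curvCoord, add_mul, sub_mul, Finset.sum_add_distrib, Finset.sum_sub_distrib]
  ring

/-- The curvature tensor is skew-symmetric in its first two indices. -/
theorem curvCoord_skew (hG : IsMetricOn U G) (hz : z ∈ U) (i k j l : Fin n) :
    ∑ m, G z i m * curvCoord G z m k j l = - ∑ m, G z k m * curvCoord G z m i j l := by
  have d := fun i m k l => (hG.differentiableAt_metric hz i m).fun_mul
    (hG.differentiableAt_christoffel hz m k l)
  -- Metric compatibility is differentiated again. Equality of ∂ⱼ∂ₗgᵢₖ and ∂ₗ∂ⱼgᵢₖ is the asserted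
  -- skew symmetry, once the products pairing a Christoffel symbol of i with one of k cancel (`h2`).
  have e : ∀ j l, pd j (pd l (fun y => G y i k)) z =
      ∑ m, (pd j (fun y => G y i m) z * christoffel G m k l z
        + G z i m * pd j (christoffel G m k l) z)
      + ∑ m, (pd j (fun y => G y k m) z * christoffel G m i l z
        + G z k m * pd j (christoffel G m i l) z) := by
    intro j l
    rw [pd_congr hG.isOpen hz (fun y hy => hG.pd_metric hy l i k),
      pd_add _ (DifferentiableAt.fun_sum fun m _ => d i m k l)
        (DifferentiableAt.fun_sum fun m _ => d k m i l),
      pd_sum _ _ (fun m _ => d i m k l), pd_sum _ _ (fun m _ => d k m i l)]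
    simp only [pd_mul _ (hG.differentiableAt_metric hz _ _)
      (hG.differentiableAt_christoffel hz _ _ _)]
  have hc := pd_comm hG.isOpen (hG.contDiffOn i k) hz j l
  rw [e, e] at hc
  simp only [hG.pd_metric hz, add_mul, Finset.sum_add_distrib] at hc
  have h1 : ∀ i k j l, ∑ m, (∑ r, G z i r * christoffel G r m j z) * christoffel G m k l z
      = ∑ m, G z i m * ∑ r, christoffel G r k l z * christoffel G m r j z := by
    intro i k j l
    simp only [Finset.mul_sum, Finset.sum_mul]
    rw [Finset.sum_comm]
    exact Finset.sum_congr rfl fun i _ => Finset.sum_congr rfl fun m _ => by ring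
  have h2 : ∀ i k j l, ∑ m, (∑ r, G z m r * christoffel G r i j z) * christoffel G m k l z
      = ∑ m, (∑ r, G z m r * christoffel G r k l z) * christoffel G m i j z := by
    intro i k j l
    simp only [Finset.sum_mul]
    rw [Finset.sum_comm]
    refine Finset.sum_congr rfl fun m _ => Finset.sum_congr rfl fun r _ => ?_
    rw [hG.symm hz r m]; ring
  simp only [h1] at hc
  rw [h2 i k j l, h2 i k l j] at hc
  simp only [curvCoord, mul_add, mul_sub, Finset.sum_add_distrib, Finset.sum_sub_distrib]
  linarith

/-- Torsion-freeness reconciles the two index conventions, so that the traced Ricci identity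
produces the Ricci tensor as it was defined. -/
theorem ricciCoord_eq (hG : IsMetricOn U G) (hz : z ∈ U) (i j : Fin n) :
    ricciCoord G z i j = ∑ k, curvCoord G z k j k i := by
  have h3 : ∀ a b c m, pd a (christoffel G m b c) z = pd a (christoffel G m c b) z :=
    fun a b c m => pd_congr hG.isOpen hz (fun y hy => hG.christoffel_symm hy m b c) a
  simp only [ricciCoord, curvCoord, Finset.sum_add_distrib, Finset.sum_sub_distrib]
  have h1 : ∑ k, ∑ l, christoffel G k i j z * christoffel G l l k z
      = ∑ k, ∑ l, christoffel G l j i z * christoffel G k l k z := by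
    rw [Finset.sum_comm]
    refine Finset.sum_congr rfl fun m _ => Finset.sum_congr rfl fun r _ => ?_
    rw [hG.christoffel_symm hz r i j, hG.christoffel_symm hz m r m]
  have h2 : ∑ k, ∑ l, christoffel G l i k z * christoffel G k l j z
      = ∑ k, ∑ l, christoffel G l j k z * christoffel G k l i z := by
    rw [Finset.sum_comm]
    refine Finset.sum_congr rfl fun m _ => Finset.sum_congr rfl fun r _ => ?_
    rw [hG.christoffel_symm hz m i r, hG.christoffel_symm hz r m j]; ring
  rw [h1, h2]
  simp only [h3 _ i j, h3 i _ j]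

/-- Writing dφ as the lowered gradient and using skew symmetry moves the index k onto a factor g,
which g⁻¹ then cancels. What remains is the trace of the curvature defining Ric. -/
theorem sum_inv_mul_curvCoord (hG : IsMetricOn U G) (hz : z ∈ U) (φ : Model n → ℝ) (j : Fin n) :
    ∑ k, ∑ l, (G z)⁻¹ k l * ∑ m, curvCoord G z m k j l * pd m φ z
      = ∑ i, ricciCoord G z j i * gradCoord G φ i z := by
  have h1 : ∀ k l, ∑ m, curvCoord G z m k j l * pd m φ z
      = - ∑ m, G z k m * ∑ i, curvCoord G z m i j l * gradCoord G φ i z := by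
    intro k l
    calc ∑ m, curvCoord G z m k j l * pd m φ z
        = ∑ i, (∑ m, G z i m * curvCoord G z m k j l) * gradCoord G φ i z := by
          simp only [← hG.sum_mul_gradCoord hz φ, Finset.sum_mul, Finset.mul_sum]
          rw [Finset.sum_comm]
          refine Finset.sum_congr rfl fun m _ => Finset.sum_congr rfl fun r _ => ?_
          rw [hG.symm hz m r]; ring
      _ = - ∑ i, (∑ m, G z k m * curvCoord G z m i j l) * gradCoord G φ i z := by
          simp only [hG.curvCoord_skew hz _ k, neg_mul, Finset.sum_neg_distrib]
      _ = _ := by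
          simp only [Finset.sum_mul, Finset.mul_sum]
          rw [Finset.sum_comm]
          congr 1
          exact Finset.sum_congr rfl fun i _ => Finset.sum_congr rfl fun m _ => by ring
  have h2 : ∀ l, ∑ k, (G z)⁻¹ k l * ∑ m, curvCoord G z m k j l * pd m φ z
      = - ∑ i, curvCoord G z l i j l * gradCoord G φ i z := by
    intro l
    rw [← hG.sum_inv_mul hz (fun m => ∑ i, curvCoord G z m i j l * gradCoord G φ i z) l,
      ← Finset.sum_neg_distrib]
    refine Finset.sum_congr rfl fun k _ => ?_
    rw [h1, hG.inv_symm hz k l]; ring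
  rw [Finset.sum_comm]
  simp only [h2, hG.ricciCoord_eq hz, Finset.sum_mul]
  rw [Finset.sum_neg_distrib, Finset.sum_comm, ← Finset.sum_neg_distrib]
  refine Finset.sum_congr rfl fun i _ => ?_
  rw [← Finset.sum_neg_distrib]
  refine Finset.sum_congr rfl fun l _ => ?_
  have : curvCoord G z l i j l = - curvCoord G z l i l j := by
    simp only [curvCoord, Finset.sum_sub_distrib]; ring
  rw [this]; ring

theorem covHess_symm (hG : IsMetricOn U G) (hφ : ContDiffOn ℝ 2 φ U) (hz : z ∈ U)
    (k i l : Fin n) : covHess G φ z k i l = covHess G φ z k l i := by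
  unfold covHess
  rw [pd_congr hG.isOpen hz (fun y hy => hG.hessCoord_symm hφ hy i l)]
  simp only [hG.hessCoord_symm hφ hz i, hG.hessCoord_symm hφ hz _ l]
  ring

/-- Bochner's formula in coordinates. -/
theorem bochner (hG : IsMetricOn U G) (hφ : ContDiffOn ℝ 3 φ U) (hz : z ∈ U) :
    laplaceCoord G (innerCoord G φ φ) z =
      2 * ∑ k, ∑ l, (G z)⁻¹ k l *
        ∑ i, hessCoord G φ z l i * ∑ m, (G z)⁻¹ i m * hessCoord G φ z k m
      + 2 * ∑ i, gradCoord G φ i z * pd i (laplaceCoord G φ) z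
      + 2 * ∑ i, ∑ j, ricciCoord G z i j * gradCoord G φ i z * gradCoord G φ j z := by
  have hφ2 : ContDiffOn ℝ 2 φ U := hφ.of_le (by norm_num)
  -- The traced Ricci identity: commuting derivatives turns the rough Laplacian of dφ into dΔφ plus
  -- Ric applied to ∇φ.
  have h1 : ∀ i, ∑ k, ∑ l, (G z)⁻¹ k l * covHess G φ z k l i
      = pd i (laplaceCoord G φ) z + ∑ j, ricciCoord G z i j * gradCoord G φ j z := by
    intro i
    rw [hG.pd_laplaceCoord hφ hz, ← hG.sum_inv_mul_curvCoord hz, Finset.sum_comm,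
      Finset.sum_comm (f := fun k l => (G z)⁻¹ k l * covHess G φ z i k l), ← Finset.sum_add_distrib]
    refine Finset.sum_congr rfl fun l _ => ?_
    rw [← Finset.sum_add_distrib]
    refine Finset.sum_congr rfl fun k _ => ?_
    rw [hG.inv_symm hz k l, ← hG.covHess_sub_covHess hφ hz k i l, hG.covHess_symm hφ2 hz k l i]
    ring
  have h2 : ∑ k, ∑ l, (G z)⁻¹ k l * ∑ i, gradCoord G φ i z * covHess G φ z k l i
      = ∑ i, gradCoord G φ i z * (pd i (laplaceCoord G φ) z
        + ∑ j, ricciCoord G z i j * gradCoord G φ j z) := by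
    simp only [← h1, Finset.mul_sum]
    rw [Finset.sum_congr rfl fun k _ => Finset.sum_comm, Finset.sum_comm]
    exact Finset.sum_congr rfl fun i _ => Finset.sum_congr rfl fun k _ =>
      Finset.sum_congr rfl fun l _ => by ring
  conv_lhs => unfold laplaceCoord
  simp only [hG.hessCoord_innerCoord_self hφ hz, mul_add, Finset.sum_add_distrib,
    mul_left_comm _ (2 : ℝ), ← Finset.mul_sum, h2]
  have h3 : ∑ i, ∑ j, ricciCoord G z i j * gradCoord G φ i z * gradCoord G φ j z
      = ∑ i, gradCoord G φ i z * ∑ j, ricciCoord G z i j * gradCoord G φ j z := by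
    simp only [Finset.mul_sum]
    exact Finset.sum_congr rfl fun i _ => Finset.sum_congr rfl fun k _ => by ring
  rw [h3]; ring

end IsMetricOn
end Coordinates

/-! ### Matrix inequalities -/

section MatrixInequalities

variable {n : ℕ}

open scoped MatrixOrder in
theorem exists_eq_transpose_mul_self {P : Matrix (Fin n) (Fin n) ℝ} (hP : P.PosSemidef) :
    ∃ S : Matrix (Fin n) (Fin n) ℝ, P = S.transpose * S := by
  obtain ⟨S, hS⟩ := CStarAlgebra.nonneg_iff_eq_star_mul_self.1 (Matrix.nonneg_iff_posSemidef.2 hP)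
  exact ⟨S, by rw [hS, Matrix.star_eq_conjTranspose, Matrix.conjTranspose_eq_transpose_of_trivial]⟩

/-- With P = SᵀS the trace is the squared Frobenius norm of the symmetric matrix SDSᵀ. -/
theorem trace_mul_mul_mul_nonneg {P D : Matrix (Fin n) (Fin n) ℝ} (hP : P.PosSemidef)
    (hD : D.transpose = D) : 0 ≤ (P * D * P * D).trace := by
  obtain ⟨S, hS⟩ := exists_eq_transpose_mul_self hP
  have h : (P * D * P * D).trace = ((S * D * S.transpose) * (S * D * S.transpose).transpose).trace := by
    rw [hS]
    simp only [Matrix.transpose_mul, Matrix.transpose_transpose, hD, Matrix.mul_assoc]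
    rw [Matrix.trace_mul_comm]
    simp only [Matrix.mul_assoc]
  rw [h]
  simp only [Matrix.trace, Matrix.diag, Matrix.mul_apply, Matrix.transpose_apply]
  exact Finset.sum_nonneg fun i _ => Finset.sum_nonneg fun j _ => mul_self_nonneg _

/-- This is the expanded square of H + αG + βw⊗w, measured with P = G⁻¹. Keeping α and β free allows
them to be chosen later, at the maximum point. -/
theorem trace_hess_lower_bound {P G H : Matrix (Fin n) (Fin n) ℝ} (hP : P.PosSemidef)
    (hPG : P * G = 1) (hG : G.transpose = G) (hH : H.transpose = H) (w : Fin n → ℝ) (α β : ℝ) :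
    0 ≤ (P * H * P * H).trace + α ^ 2 * n + β ^ 2 * (w ⬝ᵥ P.mulVec w) ^ 2
      + 2 * α * (P * H).trace + 2 * β * (P.mulVec w ⬝ᵥ H.mulVec (P.mulVec w))
      + 2 * α * β * (w ⬝ᵥ P.mulVec w) := by
  have hPt : P.transpose = P := by
    simpa [Matrix.IsHermitian, Matrix.conjTranspose_eq_transpose_of_trivial] using hP.isHermitian
  have hD : (H + α • G + β • Matrix.vecMulVec w w).transpose
      = H + α • G + β • Matrix.vecMulVec w w := by
    simp only [Matrix.transpose_add, Matrix.transpose_smul, hH, hG, Matrix.transpose_vecMulVec]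
  have h := trace_mul_mul_mul_nonneg hP hD
  have e1 : ∀ X : Matrix (Fin n) (Fin n) ℝ, (P * X * P * Matrix.vecMulVec w w).trace
      = P.mulVec w ⬝ᵥ X.mulVec (P.mulVec w) := by
    intro X
    rw [Matrix.mul_vecMulVec, Matrix.trace_vecMulVec, ← Matrix.mulVec_mulVec, ← Matrix.mulVec_mulVec,
      dotProduct_comm, Matrix.dotProduct_mulVec, ← Matrix.mulVec_transpose, hPt]
  have e2 : ∀ X : Matrix (Fin n) (Fin n) ℝ, (P * Matrix.vecMulVec w w * P * X).trace
      = P.mulVec w ⬝ᵥ X.mulVec (P.mulVec w) := by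
    intro X
    rw [← e1, Matrix.mul_assoc, Matrix.trace_mul_comm, ← Matrix.mul_assoc]
  have e3 : P.mulVec w ⬝ᵥ G.mulVec (P.mulVec w) = w ⬝ᵥ P.mulVec w := by
    rw [Matrix.mulVec_mulVec, mul_eq_one_comm.1 hPG, Matrix.one_mulVec, dotProduct_comm]
  have e4 : P.mulVec w ⬝ᵥ (Matrix.vecMulVec w w).mulVec (P.mulVec w)
      = (w ⬝ᵥ P.mulVec w) ^ 2 := by
    rw [Matrix.vecMulVec_mulVec, dotProduct_smul]
    simp [dotProduct_comm (P.mulVec w) w, pow_two]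
  have e5 : (P * H * P * G).trace = (P * H).trace := by
    rw [Matrix.mul_assoc, hPG, Matrix.mul_one]
  simp only [Matrix.mul_add, Matrix.add_mul, Matrix.mul_smul, Matrix.smul_mul, Matrix.trace_add,
    Matrix.trace_smul, smul_eq_mul, e1, e2, e3, e4, e5] at h
  simp only [hPG, Matrix.one_mul, Matrix.trace_one, Fintype.card_fin] at h
  linarith

/-- With P = SᵀS the pairing is the sum of the values of the quadratic form A on the rows of S. -/
theorem sum_mul_nonpos_of_posSemidef {P A : Matrix (Fin n) (Fin n) ℝ} (hP : P.PosSemidef)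
    (hA : ∀ w : Fin n → ℝ, ∑ i, ∑ j, w i * w j * A i j ≤ 0) : ∑ i, ∑ j, P i j * A i j ≤ 0 := by
  obtain ⟨S, hS⟩ := exists_eq_transpose_mul_self hP
  have : ∑ i, ∑ j, P i j * A i j = ∑ r, ∑ i, ∑ j, S r i * S r j * A i j := by
    rw [hS]
    simp only [Matrix.mul_apply, Matrix.transpose_apply, Finset.sum_mul]
    rw [Finset.sum_congr rfl fun i _ => Finset.sum_comm, Finset.sum_comm]
  rw [this]
  exact Finset.sum_nonpos fun r _ => hA (S r)

end MatrixInequalities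

section Coordinates

variable {n : ℕ} {U : Set (Model n)} {G : Model n → Matrix (Fin n) (Fin n) ℝ}
  {φ χ f h F : Model n → ℝ} {z : Model n}

/-! ### The second derivative test -/

/-- A positive second derivative would make 0 a local minimum as well; the function would then be
locally constant, with second derivative 0. -/
theorem deriv_deriv_nonpos_of_isLocalMax {c : ℝ → ℝ} (hc : IsLocalMax c 0)
    (hcont : ContinuousAt c 0) : deriv (deriv c) 0 ≤ 0 := by
  by_contra! hpos
  have hmin : IsLocalMin c 0 := isLocalMin_of_deriv_deriv_pos hpos hc.deriv_eq_zero hcont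
  have heq : c =ᶠ[nhds 0] fun _ => c 0 := by
    filter_upwards [hc, hmin] with t h1 h2 using le_antisymm h1 h2
  have h0 : deriv c =ᶠ[nhds 0] fun _ => (0 : ℝ) := by
    have := heq.deriv
    simpa using this
  rw [h0.deriv_eq] at hpos
  simp at hpos

theorem fderiv_eq_sum_pd (F : Model n → ℝ) (z : Model n) (w : Fin n → ℝ) :
    fderiv ℝ F z (WithLp.toLp 2 w) = ∑ i, w i * pd i F z := by
  have : (WithLp.toLp 2 w : Model n) = ∑ i, w i • EuclideanSpace.single i (1 : ℝ) := by
    ext j; simp [Finset.sum_apply, Pi.single_apply]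
  rw [this, map_sum]
  simp [pd]

theorem sum_pd_pd_nonpos_of_isLocalMax (hU : IsOpen U) (hF : ContDiffOn ℝ 2 F U) (hz : z ∈ U)
    (hmax : IsLocalMax F z) (w : Fin n → ℝ) : ∑ i, ∑ j, w i * w j * pd i (pd j F) z ≤ 0 := by
  set W : Model n := WithLp.toLp 2 w with hW
  have hl : ∀ t : ℝ, HasDerivAt (fun t : ℝ => z + t • W) W t := fun t => by
    simpa using ((hasDerivAt_id t).smul_const W).const_add z
  have hcont : Continuous (fun t : ℝ => z + t • W) := by fun_prop
  have h0 : z + (0 : ℝ) • W = z := by simp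
  have hnear : ∀ᶠ t in nhds (0 : ℝ), z + t • W ∈ U :=
    hcont.continuousAt.eventually_mem (by rw [h0]; exact hU.mem_nhds hz)
  have hd : ∀ {H : Model n → ℝ} {t : ℝ}, DifferentiableAt ℝ H (z + t • W) →
      HasDerivAt (fun t : ℝ => H (z + t • W)) (∑ i, w i * pd i H (z + t • W)) t := by
    intro H t hH
    rw [← fderiv_eq_sum_pd]
    exact hH.hasFDerivAt.comp_hasDerivAt t (hl t)
  have h1 : deriv (fun t : ℝ => F (z + t • W)) =ᶠ[nhds 0]
      fun t => ∑ j, w j * pd j F (z + t • W) := by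
    filter_upwards [hnear] with t ht
    exact (hd (differentiableAt_of_contDiffOn hU hF (by norm_num) ht)).deriv
  have hp : ∀ j, DifferentiableAt ℝ (pd j F) (z + (0 : ℝ) • W) := fun j => by
    rw [h0]
    exact differentiableAt_of_contDiffOn hU (contDiffOn_pd (l := 1) hU hF (by norm_num) j) le_rfl hz
  have h2 : deriv (deriv (fun t : ℝ => F (z + t • W))) 0
      = ∑ j, w j * ∑ i, w i * pd i (pd j F) z := by
    rw [h1.deriv_eq]
    have := HasDerivAt.fun_sum (u := Finset.univ) fun j _ => (hd (hp j)).const_mul (w j)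
    rw [this.deriv, h0]
  have h3 : ∑ i, ∑ j, w i * w j * pd i (pd j F) z = ∑ j, w j * ∑ i, w i * pd i (pd j F) z := by
    rw [Finset.sum_comm]
    simp only [Finset.mul_sum]
    exact Finset.sum_congr rfl fun i _ => Finset.sum_congr rfl fun j _ => by ring
  rw [h3, ← h2]
  refine deriv_deriv_nonpos_of_isLocalMax ?_ ?_
  · have : Filter.Tendsto (fun t : ℝ => z + t • W) (nhds 0) (nhds z) := by
      simpa [h0] using hcont.tendsto 0
    have h4 := this.eventually hmax
    simpa [IsLocalMax, IsMaxFilter] using h4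
  · exact (hd (differentiableAt_of_contDiffOn hU hF (by norm_num) (by rw [h0]; exact hz))).continuousAt

theorem pd_eq_zero_of_isLocalMax (hmax : IsLocalMax F z) (i : Fin n) : pd i F z = 0 := by
  simp [pd, hmax.fderiv_eq_zero]

namespace IsMetricOn

theorem laplaceCoord_nonpos_of_isLocalMax (hG : IsMetricOn U G) (hF : ContDiffOn ℝ 2 F U)
    (hz : z ∈ U) (hmax : IsLocalMax F z) : laplaceCoord G F z ≤ 0 := by
  have := sum_mul_nonpos_of_posSemidef (A := fun i j => pd i (pd j F) z)
    (hG.posDef z hz).inv.posSemidef (sum_pd_pd_nonpos_of_isLocalMax hG.isOpen hF hz hmax)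
  simpa [laplaceCoord, hessCoord, pd_eq_zero_of_isLocalMax hmax] using this

/-! ### Leibniz and chain rules -/

/-- Only dF = h dφ enters, so this is the product rule for div(h∇φ). It serves both for powers of v
and for d(u^p) = u dv in the pressure equation. -/
theorem laplaceCoord_of_pd_eq (hG : IsMetricOn U G) (hφ : ContDiffOn ℝ 2 φ U)
    (hh : ContDiffOn ℝ 1 h U) (hz : z ∈ U) (hF : ∀ y ∈ U, ∀ j, pd j F y = h y * pd j φ y) :
    laplaceCoord G F z = h z * laplaceCoord G φ z + innerCoord G h φ z := by
  have d1 := differentiableAt_of_contDiffOn hG.isOpen hh le_rfl hz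
  have d2 : ∀ i, DifferentiableAt ℝ (pd i φ) z := fun i =>
    differentiableAt_of_contDiffOn hG.isOpen
      (contDiffOn_pd (l := 1) hG.isOpen hφ (by norm_num) i) le_rfl hz
  have e : ∀ i j, hessCoord G F z i j = pd i h z * pd j φ z + h z * hessCoord G φ z i j := by
    intro i j
    unfold hessCoord
    rw [pd_congr hG.isOpen hz (fun y hy => hF y hy j), pd_mul _ d1 (d2 j)]
    simp only [hF z hz, mul_sub, Finset.mul_sum, mul_left_comm (h z)]
    ring
  simp only [laplaceCoord, innerCoord, gradCoord, e, mul_add, Finset.sum_add_distrib,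
    Finset.mul_sum, mul_left_comm (h z)]
  rw [add_comm]
  congr 1
  exact Finset.sum_congr rfl fun i _ => Finset.sum_congr rfl fun j _ => by ring

theorem laplaceCoord_mul (hG : IsMetricOn U G) (hh : ContDiffOn ℝ 2 h U) (hφ : ContDiffOn ℝ 2 φ U)
    (hz : z ∈ U) : laplaceCoord G (fun y => h y * φ y) z =
      h z * laplaceCoord G φ z + φ z * laplaceCoord G h z + 2 * innerCoord G h φ z := by
  have d : ∀ {ψ : Model n → ℝ}, ContDiffOn ℝ 2 ψ U → ∀ y ∈ U, DifferentiableAt ℝ ψ y :=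
    fun hψ y hy => differentiableAt_of_contDiffOn hG.isOpen hψ (by norm_num) hy
  have d' : ∀ {ψ : Model n → ℝ}, ContDiffOn ℝ 2 ψ U → ∀ i, DifferentiableAt ℝ (pd i ψ) z :=
    fun hψ i => differentiableAt_of_contDiffOn hG.isOpen
      (contDiffOn_pd (l := 1) hG.isOpen hψ (by norm_num) i) le_rfl hz
  have e : ∀ i j, hessCoord G (fun y => h y * φ y) z i j =
      h z * hessCoord G φ z i j + φ z * hessCoord G h z i j
        + (pd i h z * pd j φ z + pd j h z * pd i φ z) := by
    intro i j
    unfold hessCoord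
    rw [pd_congr hG.isOpen hz (fun y hy => pd_mul j (d hh y hy) (d hφ y hy)),
      pd_add _ ((d' hh j).fun_mul (d hφ z hz)) ((d hh z hz).fun_mul (d' hφ j)),
      pd_mul _ (d' hh j) (d hφ z hz), pd_mul _ (d hh z hz) (d' hφ j)]
    simp only [pd_mul _ (d hh z hz) (d hφ z hz), mul_sub, Finset.mul_sum, mul_add,
      Finset.sum_add_distrib, mul_left_comm _ (h z), mul_comm _ (φ z), mul_left_comm _ (φ z)]
    ring
  have e2 := hG.innerCoord_comm hz h φ
  rw [two_mul]
  nth_rewrite 2 [e2]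
  simp only [laplaceCoord, innerCoord, gradCoord, e, Finset.mul_sum, ← Finset.sum_add_distrib]
  exact Finset.sum_congr rfl fun i _ => Finset.sum_congr rfl fun j _ => by ring

theorem laplaceCoord_add_const_mul (hG : IsMetricOn U G) (hh : ContDiffOn ℝ 2 h U)
    (hφ : ContDiffOn ℝ 2 φ U) (hz : z ∈ U) (c d : ℝ) :
    laplaceCoord G (fun y => c * h y + d * φ y) z =
      c * laplaceCoord G h z + d * laplaceCoord G φ z := by
  have d1 : ∀ {ψ : Model n → ℝ}, ContDiffOn ℝ 2 ψ U → ∀ y ∈ U, DifferentiableAt ℝ ψ y :=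
    fun hψ y hy => differentiableAt_of_contDiffOn hG.isOpen hψ (by norm_num) hy
  have d' : ∀ {ψ : Model n → ℝ}, ContDiffOn ℝ 2 ψ U → ∀ i, DifferentiableAt ℝ (pd i ψ) z :=
    fun hψ i => differentiableAt_of_contDiffOn hG.isOpen
      (contDiffOn_pd (l := 1) hG.isOpen hψ (by norm_num) i) le_rfl hz
  have e0 : ∀ y ∈ U, ∀ j, pd j (fun y => c * h y + d * φ y) y = c * pd j h y + d * pd j φ y :=
    fun y hy j => by
      rw [pd_add _ ((d1 hh y hy).const_mul c) ((d1 hφ y hy).const_mul d),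
        pd_const_mul _ _ (d1 hh y hy), pd_const_mul _ _ (d1 hφ y hy)]
  have e : ∀ i j, hessCoord G (fun y => c * h y + d * φ y) z i j =
      c * hessCoord G h z i j + d * hessCoord G φ z i j := by
    intro i j
    unfold hessCoord
    rw [pd_congr hG.isOpen hz (fun y hy => e0 y hy j),
      pd_add _ ((d' hh j).const_mul c) ((d' hφ j).const_mul d),
      pd_const_mul _ _ (d' hh j), pd_const_mul _ _ (d' hφ j)]
    simp only [e0 z hz, mul_sub, mul_add, Finset.sum_add_distrib, Finset.mul_sum,
      mul_left_comm _ c, mul_left_comm _ d]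
    ring
  simp only [laplaceCoord, e, mul_add, Finset.sum_add_distrib, Finset.mul_sum,
    mul_left_comm _ c, mul_left_comm _ d]

theorem laplaceCoord_rpow (hG : IsMetricOn U G) (hφ : ContDiffOn ℝ 2 φ U)
    (hpos : ∀ y ∈ U, 0 < φ y) (hz : z ∈ U) (a : ℝ) :
    laplaceCoord G (fun y => φ y ^ a) z =
      a * φ z ^ (a - 1) * laplaceCoord G φ z
        + a * (a - 1) * φ z ^ (a - 2) * innerCoord G φ φ z := by
  have d1 : ∀ y ∈ U, DifferentiableAt ℝ φ y :=
    fun y hy => differentiableAt_of_contDiffOn hG.isOpen hφ (by norm_num) hy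
  have hh : ContDiffOn ℝ 1 (fun y => a * φ y ^ (a - 1)) U :=
    contDiffOn_const.mul ((hφ.of_le (by norm_num)).rpow_const_of_ne fun y hy => (hpos y hy).ne')
  rw [hG.laplaceCoord_of_pd_eq hφ hh hz (fun y hy j =>
    pd_comp j (Real.hasDerivAt_rpow_const (Or.inl (hpos y hy).ne')) (d1 y hy))]
  congr 1
  have : ∀ i, pd i (fun y => a * φ y ^ (a - 1)) z = a * (a - 1) * φ z ^ (a - 2) * pd i φ z := by
    intro i
    rw [pd_comp (θ := fun x => a * x ^ (a - 1)) i
      ((Real.hasDerivAt_rpow_const (Or.inl (hpos z hz).ne')).const_mul a) (d1 z hz)]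
    rw [show a - 1 - 1 = a - 2 by ring]; ring
  simp only [innerCoord, this, Finset.mul_sum, mul_assoc]

/-! ### Bochner's formula for the drift Laplacian -/

theorem innerCoord_eq_sum (hG : IsMetricOn U G) (hz : z ∈ U) (φ χ : Model n → ℝ) :
    innerCoord G φ χ z = ∑ i, gradCoord G φ i z * pd i χ z := by
  rw [hG.innerCoord_comm hz]
  exact Finset.sum_congr rfl fun i _ => mul_comm _ _

theorem innerCoord_innerCoord (hG : IsMetricOn U G) (hφ : ContDiffOn ℝ 2 φ U)
    (hχ : ContDiffOn ℝ 2 χ U) (hz : z ∈ U) (f : Model n → ℝ) :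
    innerCoord G f (innerCoord G φ χ) z =
      ∑ i, ∑ j, hessCoord G φ z i j * gradCoord G f i z * gradCoord G χ j z
      + ∑ i, ∑ j, hessCoord G χ z i j * gradCoord G f i z * gradCoord G φ j z := by
  rw [hG.innerCoord_eq_sum hz]
  simp only [hG.pd_innerCoord hφ hχ hz, mul_add, Finset.sum_add_distrib, Finset.mul_sum]
  congr 1 <;>
  exact Finset.sum_congr rfl fun i _ => Finset.sum_congr rfl fun j _ => by ring

/-- Bochner's formula for the drift Laplacian `Δ - ⟨∇f, ∇·⟩`. -/
theorem bochner_drift (hG : IsMetricOn U G) (hφ : ContDiffOn ℝ 3 φ U) (hf : ContDiffOn ℝ 2 f U)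
    (hz : z ∈ U) :
    laplaceCoord G (innerCoord G φ φ) z - innerCoord G f (innerCoord G φ φ) z =
      2 * ((G z)⁻¹ * Matrix.of (hessCoord G φ z) * (G z)⁻¹ * Matrix.of (hessCoord G φ z)).trace
      + 2 * ∑ i, gradCoord G φ i z * pd i (fun y => laplaceCoord G φ y - innerCoord G f φ y) z
      + 2 * ∑ i, ∑ j, ricciCoord G z i j * gradCoord G φ i z * gradCoord G φ j z
      + 2 * ∑ i, ∑ j, hessCoord G f z i j * gradCoord G φ i z * gradCoord G φ j z := by
  have hφ2 : ContDiffOn ℝ 2 φ U := hφ.of_le (by norm_num)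
  have d1 : DifferentiableAt ℝ (laplaceCoord G φ) z :=
    DifferentiableAt.fun_sum fun i _ => DifferentiableAt.fun_sum fun j _ =>
      (hG.differentiableAt_inv hz i j).fun_mul (hG.differentiableAt_hessCoord hφ hz i j)
  have d2 : DifferentiableAt ℝ (innerCoord G f φ) z :=
    differentiableAt_of_contDiffOn hG.isOpen
      (hG.contDiffOn_innerCoord (l := 1) hf hφ2 (by norm_num) (by norm_num)) le_rfl hz
  have e1 : ∑ i, gradCoord G φ i z * pd i (fun y => laplaceCoord G φ y - innerCoord G f φ y) z
      = ∑ i, gradCoord G φ i z * pd i (laplaceCoord G φ) z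
        - innerCoord G φ (innerCoord G f φ) z := by
    rw [hG.innerCoord_eq_sum hz φ]
    simp only [pd_sub _ d1 d2, mul_sub, Finset.sum_sub_distrib]
  have e2 : (((G z)⁻¹ * Matrix.of (hessCoord G φ z) * (G z)⁻¹
      * Matrix.of (hessCoord G φ z)).trace) = ∑ k, ∑ l, (G z)⁻¹ k l *
        ∑ i, hessCoord G φ z l i * ∑ m, (G z)⁻¹ i m * hessCoord G φ z k m := by
    rw [Matrix.mul_assoc, Matrix.mul_assoc]
    simp only [Matrix.trace, Matrix.diag, Matrix.mul_apply, Matrix.of_apply]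
    refine Finset.sum_congr rfl fun k _ => Finset.sum_congr rfl fun l _ => ?_
    refine congrArg _ (Finset.sum_congr rfl fun i _ =>
      congrArg _ (Finset.sum_congr rfl fun m _ => ?_))
    rw [hG.hessCoord_symm hφ2 hz m k]
  have e3 : ∑ i, ∑ j, hessCoord G φ z i j * gradCoord G f i z * gradCoord G φ j z
      = ∑ i, ∑ j, hessCoord G φ z i j * gradCoord G φ i z * gradCoord G f j z := by
    rw [Finset.sum_comm]
    refine Finset.sum_congr rfl fun i _ => Finset.sum_congr rfl fun j _ => ?_
    rw [hG.hessCoord_symm hφ2 hz j i]; ring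
  -- Differentiating ⟨∇f,∇φ⟩ along ∇φ gives ∇∇f(∇φ,∇φ) and ∇∇φ(∇f,∇φ). The latter cancels against
  -- the drift of |∇φ|², so only the Hessian of f remains.
  rw [hG.bochner hφ hz, e1, e2, hG.innerCoord_innerCoord hf hφ2 hz,
    hG.innerCoord_innerCoord hφ2 hφ2 hz, e3]
  ring

/-- The matrix inequality with w = dφ; its mixed term is recognised through 2∇∇φ(∇φ,∇φ) =
⟨∇φ,∇|∇φ|²⟩. -/
theorem hess_lower_bound (hG : IsMetricOn U G) (hφ : ContDiffOn ℝ 2 φ U) (hz : z ∈ U) (α β : ℝ) :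
    0 ≤ ((G z)⁻¹ * Matrix.of (hessCoord G φ z) * (G z)⁻¹ * Matrix.of (hessCoord G φ z)).trace
      + α ^ 2 * n + β ^ 2 * innerCoord G φ φ z ^ 2 + 2 * α * laplaceCoord G φ z
      + β * innerCoord G φ (innerCoord G φ φ) z + 2 * α * β * innerCoord G φ φ z := by
  have h := trace_hess_lower_bound (G := G z) (H := Matrix.of (hessCoord G φ z))
    (hG.posDef z hz).inv.posSemidef
    (Matrix.nonsing_inv_mul _ (hG.det_ne_zero z hz).isUnit)
    (by ext i j; exact hG.symm hz j i) (by ext i j; exact hG.hessCoord_symm hφ hz j i)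
    (fun i => pd i φ z) α β
  have e1 : (fun i => pd i φ z) ⬝ᵥ ((G z)⁻¹).mulVec (fun i => pd i φ z) = innerCoord G φ φ z := rfl
  have e2 : ((G z)⁻¹ * Matrix.of (hessCoord G φ z)).trace = laplaceCoord G φ z := by
    simp only [Matrix.trace, Matrix.diag, Matrix.mul_apply, Matrix.of_apply, laplaceCoord]
    refine Finset.sum_congr rfl fun k _ => Finset.sum_congr rfl fun l _ => ?_
    rw [hG.hessCoord_symm hφ hz l k]
  have e3 : 2 * (((G z)⁻¹).mulVec (fun i => pd i φ z) ⬝ᵥ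
      (Matrix.of (hessCoord G φ z)).mulVec (((G z)⁻¹).mulVec (fun i => pd i φ z)))
      = innerCoord G φ (innerCoord G φ φ) z := by
    rw [hG.innerCoord_innerCoord hφ hφ hz, ← two_mul]
    congr 1
    change ∑ k, gradCoord G φ k z * ∑ l, hessCoord G φ z k l * gradCoord G φ l z = _
    refine Finset.sum_congr rfl fun k _ => ?_
    rw [Finset.mul_sum]
    exact Finset.sum_congr rfl fun l _ => by ring
  rw [e1, e2] at h
  rw [← e3]
  linarith

end IsMetricOn
end Coordinates

/-! ### Mixed space-time derivatives -/

section SpaceTime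

variable {n : ℕ} {U : Set (Model n)} {T : ℝ} {Φ : Model n × ℝ → ℝ} {z : Model n} {t : ℝ}

theorem uniqueDiffOn_spaceTime (hU : IsOpen U) (hT : 0 < T) :
    UniqueDiffOn ℝ (U ×ˢ Set.Icc 0 T) :=
  hU.uniqueDiffOn.prod (uniqueDiffOn_Icc hT)

theorem contDiffOn_slice {k : WithTop ℕ∞} (hΦ : ContDiffOn ℝ k Φ (U ×ˢ Set.Icc 0 T))
    (ht : t ∈ Set.Icc 0 T) : ContDiffOn ℝ k (fun y => Φ (y, t)) U :=
  hΦ.comp (contDiff_prodMk_left t).contDiffOn fun _ hy => ⟨hy, ht⟩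

theorem contDiffOn_time_slice {k : WithTop ℕ∞} (hΦ : ContDiffOn ℝ k Φ (U ×ˢ Set.Icc 0 T))
    (hz : z ∈ U) : ContDiffOn ℝ k (fun s => Φ (z, s)) (Set.Icc 0 T) :=
  hΦ.comp (contDiff_prodMk_right z).contDiffOn fun _ hy => ⟨hz, hy⟩

/-- Identifying the slice derivative with a component of the space-time differential gives access to
its regularity jointly in space and time. -/
theorem pd_slice (hU : IsOpen U) (hΦ : DifferentiableOn ℝ Φ (U ×ˢ Set.Icc 0 T)) (hz : z ∈ U)
    (ht : t ∈ Set.Icc 0 T) (i : Fin n) :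
    pd i (fun y => Φ (y, t)) z =
      fderivWithin ℝ Φ (U ×ˢ Set.Icc 0 T) (z, t) (EuclideanSpace.single i 1, 0) := by
  have h0 : HasFDerivWithinAt (fun y : Model n => (y, t))
      (ContinuousLinearMap.inl ℝ (Model n) ℝ) U z := (hasFDerivAt_prodMk_left z t).hasFDerivWithinAt
  have hm : Set.MapsTo (fun y : Model n => (y, t)) U (U ×ˢ Set.Icc 0 T) := fun y hy => ⟨hy, ht⟩
  have h := (hΦ (z, t) ⟨hz, ht⟩).hasFDerivWithinAt.comp z h0 hm
  have h' := h.hasFDerivAt (hU.mem_nhds hz)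
  unfold pd
  rw [show (fun y => Φ (y, t)) = Φ ∘ fun y => (y, t) from rfl, h'.fderiv]
  simp

theorem hasDerivWithinAt_slice (hΦ : DifferentiableOn ℝ Φ (U ×ˢ Set.Icc 0 T))
    (hz : z ∈ U) (ht : t ∈ Set.Icc 0 T) :
    HasDerivWithinAt (fun s => Φ (z, s))
      (fderivWithin ℝ Φ (U ×ˢ Set.Icc 0 T) (z, t) (0, 1)) (Set.Icc 0 T) t := by
  have h := (hΦ (z, t) ⟨hz, ht⟩).hasFDerivWithinAt.comp_hasDerivWithinAt t
    (f := fun s => (z, s)) (f' := (0, 1)) (s := Set.Icc 0 T)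
    ((hasDerivAt_const t z).prodMk (hasDerivAt_id t)).hasDerivWithinAt (fun y hy => ⟨hz, hy⟩)
  exact h

/-- Time and space derivatives commute, including at the end points of the time interval. -/
theorem hasDerivWithinAt_pd (hU : IsOpen U) (hT : 0 < T)
    (hΦ : ContDiffOn ℝ 2 Φ (U ×ˢ Set.Icc 0 T)) (hz : z ∈ U) (ht : t ∈ Set.Icc 0 T) (i : Fin n) :
    HasDerivWithinAt (fun s => pd i (fun y => Φ (y, s)) z)
      (pd i (fun y => derivWithin (fun s => Φ (y, s)) (Set.Icc 0 T) t) z) (Set.Icc 0 T) t := by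
  set S := U ×ˢ Set.Icc 0 T with hS
  have hu : UniqueDiffOn ℝ S := uniqueDiffOn_spaceTime hU hT
  have hd : DifferentiableOn ℝ Φ S := hΦ.differentiableOn (by norm_num)
  have hd2 : DifferentiableOn ℝ (fderivWithin ℝ Φ S) S :=
    (hΦ.fderivWithin (m := 1) hu (by norm_num)).differentiableOn (by norm_num)
  have hx : (z, t) ∈ S := ⟨hz, ht⟩
  -- At t = 0 and t = T the point lies on the boundary; the second differential within the set is
  -- still symmetric there, the point being a limit of interior points.
  have hcl : (z, t) ∈ closure (interior S) := by
    rw [hS, interior_prod_eq, hU.interior_eq, interior_Icc, closure_prod_eq, closure_Ioo hT.ne]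
    exact ⟨subset_closure hz, ht⟩
  have hsymm : IsSymmSndFDerivWithinAt ℝ Φ S (z, t) :=
    (hΦ (z, t) hx).isSymmSndFDerivWithinAt (by simp) hu hcl hx
  have happ : ∀ w : Model n × ℝ, DifferentiableOn ℝ (fun x => fderivWithin ℝ Φ S x w) S :=
    fun w x hx => (hd2 x hx).clm_apply (differentiableWithinAt_const w)
  have hfd : ∀ w w' : Model n × ℝ, fderivWithin ℝ (fun x => fderivWithin ℝ Φ S x w) S (z, t) w'
      = fderivWithin ℝ (fderivWithin ℝ Φ S) S (z, t) w' w := by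
    intro w w'
    rw [fderivWithin_clm_apply (hu _ hx) (hd2 _ hx) (differentiableWithinAt_const w)]
    simp
  have h1 := hasDerivWithinAt_slice (happ (EuclideanSpace.single i 1, 0)) hz ht
  rw [hfd, hsymm, ← hfd, ← pd_slice hU (happ (0, 1)) hz ht i] at h1
  rw [pd_congr hU hz (fun y hy => (hasDerivWithinAt_slice hd hy ht).derivWithin
    (uniqueDiffOn_Icc hT t ht)) i]
  exact h1.congr (fun s hs => pd_slice hU hd hz hs i) (pd_slice hU hd hz ht i)

theorem continuousOn_pd (hU : IsOpen U) (hT : 0 < T)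
    (hΦ : ContDiffOn ℝ 1 Φ (U ×ˢ Set.Icc 0 T)) (i : Fin n) :
    ContinuousOn (fun x : Model n × ℝ => pd i (fun y => Φ (y, x.2)) x.1) (U ×ˢ Set.Icc 0 T) := by
  have h := (hΦ.continuousOn_fderivWithin (uniqueDiffOn_spaceTime hU hT) le_rfl).clm_apply
    (continuousOn_const (c := ((EuclideanSpace.single i 1, 0) : Model n × ℝ)))
  exact h.congr fun x hx => pd_slice hU (hΦ.differentiableOn (by norm_num)) hx.1 hx.2 i

/-- The time derivative of `|∇φ|²` when both the metric and the function evolve. -/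
theorem hasDerivWithinAt_innerCoord {D : Set ℝ} (hu : UniqueDiffWithinAt ℝ D t)
    (ht : t ∈ D)
    {G : ℝ → Model n → Matrix (Fin n) (Fin n) ℝ} {φ : ℝ → Model n → ℝ} {b : Fin n → ℝ}
    (hG : ∀ i j, ContDiffOn ℝ 1 (fun s => G s z i j) D)
    (hpos : ∀ s ∈ D, (G s z).PosDef)
    (hb : ∀ i, HasDerivWithinAt (fun s => pd i (φ s) z) (b i) D t) :
    HasDerivWithinAt (fun s => innerCoord (G s) (φ s) (φ s) z)
      (2 * ∑ i, gradCoord (G t) (φ t) i z * b i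
        - ∑ i, ∑ j, derivWithin (fun s => G s z i j) D t * gradCoord (G t) (φ t) i z
            * gradCoord (G t) (φ t) j z) D t := by
  have hsm : ∀ i j, G t z i j = G t z j i := fun i j => by
    simpa using ((hpos t ht).isHermitian.apply i j).symm
  have hg : ∀ i j, HasDerivWithinAt (fun s => G s z i j)
      (derivWithin (fun s => G s z i j) D t) D t := fun i j =>
    ((hG i j).differentiableOn (by norm_num) t ht).hasDerivWithinAt
  have hP : ∀ i j, DifferentiableWithinAt ℝ (fun s => (G s z)⁻¹ i j) D t := fun i j =>
    (contDiffOn_inv_entry hG (fun s hs => (hpos s hs).det_pos.ne') i j).differentiableOn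
      (by norm_num) t ht
  have hV : ∀ i, HasDerivWithinAt (fun s => gradCoord (G s) (φ s) i z)
      (derivWithin (fun s => gradCoord (G s) (φ s) i z) D t) D t := fun i =>
    (DifferentiableWithinAt.fun_sum fun j _ =>
      (hP i j).fun_mul (hb j).differentiableWithinAt).hasDerivWithinAt
  set V' := fun i => derivWithin (fun s => gradCoord (G s) (φ s) i z) D t with hV'
  set V := fun i => gradCoord (G t) (φ t) i z with hVdef
  have hGV : ∀ s ∈ D, ∀ i, ∑ k, G s z i k * gradCoord (G s) (φ s) k z = pd i (φ s) z := by
    intro s hs i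
    have h := Matrix.mul_nonsing_inv (G s z) (hpos s hs).det_pos.ne'.isUnit
    have := congrFun (Matrix.mulVec_mulVec (fun j => pd j (φ s) z) (G s z) (G s z)⁻¹) i
    rw [h, Matrix.one_mulVec] at this
    exact this
  -- With V the gradient, differentiating G V = dφ in time gives Ġ V + G V' = ∂ₜdφ. This eliminates
  -- V' without any formula for the derivative of G⁻¹.
  have e : ∀ i, ∑ k, (derivWithin (fun s => G s z i k) D t * V k + G t z i k * V' k) = b i := by
    intro i
    have h := HasDerivWithinAt.fun_sum (u := Finset.univ) fun k _ => (hg i k).fun_mul (hV k)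
    have h' := h.congr (f₁ := fun s => pd i (φ s) z) (fun s hs => (hGV s hs i).symm)
      (hGV t ht i).symm
    exact hu.eq_deriv _ h' (hb i)
  have h := HasDerivWithinAt.fun_sum (u := Finset.univ) fun i _ => (hb i).fun_mul (hV i)
  refine h.congr_deriv ?_
  have e1 : ∑ i, pd i (φ t) z * V' i = ∑ i, V i * ∑ k, G t z i k * V' k := by
    simp only [← hGV t ht, Finset.sum_mul, Finset.mul_sum]
    rw [Finset.sum_comm]
    refine Finset.sum_congr rfl fun i _ => Finset.sum_congr rfl fun j _ => ?_
    rw [hsm j i]; simp only [hVdef]; ring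
  have e2 : ∀ i, ∑ k, G t z i k * V' k
      = b i - ∑ k, derivWithin (fun s => G s z i k) D t * V k := fun i => by
    rw [← e i, Finset.sum_add_distrib]; ring
  simp only [e2] at e1
  rw [Finset.sum_add_distrib]
  change _ + ∑ i, pd i (φ t) z * V' i = _
  rw [e1]
  simp only [mul_sub, Finset.sum_sub_distrib, Finset.mul_sum, two_mul]
  rw [← add_sub_assoc, ← Finset.sum_add_distrib]
  congr 1
  · exact Finset.sum_congr rfl fun i _ => by simp only [hVdef]; ring
  · exact Finset.sum_congr rfl fun i _ => Finset.sum_congr rfl fun j _ => by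
      simp only [hVdef]; ring

end SpaceTime

/-! ### The pointwise differential inequality -/

/-- The algebraic core of the maximum principle. Here `R = ψ q + (p - 1) v` with `q = v y` and
`a = 1 / (p - 1)`; the other variables stand for the scalars entering the evolution equation of
`v ^ a * R` at a spatial maximum point. -/
theorem evolution_nonpos {p m n k a v y q R ψ ψ' L s σ Dq fq vq B X Rc Hf S Sx Sv vt qt G2 : ℝ}
    (hp : 1 < p) (hap : a * (p - 1) = 1) (hm : (m - 1) ≤ a ^ 2) (hv : 0 < v) (hy : 0 ≤ y)
    (hq : q = v * y) (hR : R = ψ * q + (p - 1) * v) (hψ : 0 ≤ ψ) (hψ' : ψ' + 2 * k * ψ ≤ p ^ 2)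
    (hpde : vt = (p - 1) * v * (L - s) + q + S)
    (hqt : qt = 2 * ((p - 1) * (L - s) * q + (p - 1) * v * X + vq + Sx + Sv * q) - G2)
    (hboch : Dq - fq = 2 * B + 2 * X + 2 * Rc + 2 * Hf)
    (hflow : -k * q ≤ (1 / 2) * G2 + (p - 1) * v * (Rc + Hf - σ))
    (hmat : ∀ α β : ℝ, 0 ≤ B + α ^ 2 * n + β ^ 2 * q ^ 2 + 2 * α * L + β * vq + 2 * α * β * q)
    (hσ : -((m - n) * y ^ 2 / 4) ≤ σ + y * s)
    (hgv : ψ * vq + (p - 1) * q = -(a * R * y))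
    (hgf : v * (ψ * fq + (p - 1) * s) = -(a * R * s))
    (hlap : -((a ^ 2 + a) * R * y) + a * R * L + v * (ψ * Dq + (p - 1) * L) ≤ 0)
    (hS : S ≤ 0) (hSx : Sx ≤ 0) (hSv : 2 * v * Sv + a * S ≤ 0) :
    a * R * vt + v * (ψ' * q + ψ * qt + (p - 1) * vt) ≤ 0 := by
  have hb : 0 < p - 1 := by linarith
  have hpa : p * a = 1 + a := by linear_combination hap
  have hB : -2 * (p - 1) * v * B ≤ (p - 1) * v * y ^ 2 / 2 * (n + a ^ 2 - 1)
      - 2 * (p - 1) * q * L + p * vq := by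
    -- The choice α = -y/2 cancels the term 2(p-1)qL in ∂ₜq, and β = pa/(2v) produces exactly p·vq.
    -- As pa = 1 + a, the remaining coefficient n + (pa)² - 2pa is n + a² - 1.
    have h := hmat (-y / 2) (p * a / (2 * v))
    have h2 : 0 ≤ 2 * (p - 1) * v * (B + (-y / 2) ^ 2 * n + (p * a / (2 * v)) ^ 2 * q ^ 2
        + 2 * (-y / 2) * L + p * a / (2 * v) * vq + 2 * (-y / 2) * (p * a / (2 * v)) * q) :=
      mul_nonneg (by positivity) h
    have e : 2 * (p - 1) * v * (B + (-y / 2) ^ 2 * n + (p * a / (2 * v)) ^ 2 * q ^ 2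
        + 2 * (-y / 2) * L + p * a / (2 * v) * vq + 2 * (-y / 2) * (p * a / (2 * v)) * q)
        = 2 * (p - 1) * v * B + (p - 1) * v * y ^ 2 / 2 * (n + (p * a) ^ 2 - 2 * (p * a))
          - 2 * (p - 1) * q * L + p * (a * (p - 1)) * vq := by
      rw [hq]; field_simp; ring
    rw [e, hpa, hap] at h2
    linarith
  have hW : qt - 2 * (p - 1) * v * (B + X + Rc + Hf) ≤
      a * v * y ^ 2 + (p + 2) * vq + 2 * k * q + 2 * Sx + 2 * Sv * q := by
    -- The drift contributes y·s from ∂ₜq and σ from the super flow inequality. The completed square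
    -- costs (m-n)y²/4, which raises n to m in the Hessian estimate.
    have h1 : -((p - 1) * v * (2 * (σ + y * s))) ≤ (p - 1) * v * ((m - n) * y ^ 2 / 2) := by
      have := mul_le_mul_of_nonneg_left hσ (show 0 ≤ 2 * ((p - 1) * v) by positivity)
      linarith
    -- The only use of the upper bound on p, in the form m - 1 ≤ a².
    have h2 : (p - 1) * v * y ^ 2 / 2 * (m - 1 + a ^ 2) ≤ a * v * y ^ 2 := by
      have h3 : (p - 1) * v * y ^ 2 / 2 * (m - 1 + a ^ 2) ≤
          (p - 1) * v * y ^ 2 / 2 * (a ^ 2 + a ^ 2) :=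
        mul_le_mul_of_nonneg_left (by linarith) (by positivity)
      have h4 : (p - 1) * v * y ^ 2 / 2 * (a ^ 2 + a ^ 2) = a * v * y ^ 2 := by
        linear_combination a * v * y ^ 2 * hap
      linarith
    have h5 : (p - 1) * q * s = (p - 1) * v * (y * s) := by rw [hq]; ring
    rw [hqt]
    linarith
  -- Up to the factor v^{a-1}, this is ∂ₜF - (p-1)vΔF. The Laplacian terms cancel by Bochner and the
  -- pressure equation, and the first-order condition along ∇f (`hgf`) removes the drift terms.
  have hE : a * R * vt + v * (ψ' * q + ψ * qt + (p - 1) * vt)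
      - (p - 1) * v * (-((a ^ 2 + a) * R * y) + a * R * L + v * (ψ * Dq + (p - 1) * L))
      = v * ((2 * a + 1) * R * y + (p - 1) * S + ψ' * q + (p - 1) * q
        + ψ * (qt - 2 * (p - 1) * v * (B + X + Rc + Hf))) + a * R * S := by
    rw [hpde]
    have e1 : a * R * ((p - 1) * v * (L - s) + q + S) =
        (a * (p - 1)) * R * v * (L - s) + a * R * q + a * R * S := by ring
    have e2 : (p - 1) * v * (-((a ^ 2 + a) * R * y) + a * R * L + v * (ψ * Dq + (p - 1) * L))
        = -((a * (p - 1)) * (a + 1) * R * (v * y)) + (a * (p - 1)) * R * v * L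
          + (p - 1) * v * (v * (ψ * Dq + (p - 1) * L)) := by ring
    have e3 : (p - 1) * v * (v * (ψ * fq + (p - 1) * s)) = -((a * (p - 1)) * R * v * s) := by
      rw [hgf]; ring
    rw [e1, e2, hap]
    rw [hap] at e3
    have e4 : Dq = fq + (2 * B + 2 * X + 2 * Rc + 2 * Hf) := by linarith
    rw [e4, ← hq]
    linear_combination -e3 + (2 * a + 1) * R * hq
  have hEle : a * R * vt + v * (ψ' * q + ψ * qt + (p - 1) * vt) ≤
      v * ((2 * a + 1) * R * y + (p - 1) * S + ψ' * q + (p - 1) * q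
        + ψ * (qt - 2 * (p - 1) * v * (B + X + Rc + Hf))) + a * R * S := by
    have := mul_nonneg (show 0 ≤ (p - 1) * v by positivity) (neg_nonneg.2 hlap)
    linarith
  refine hEle.trans ?_
  have h1 : v * ((2 * a + 1) * R * y + (p - 1) * S + ψ' * q + (p - 1) * q
        + ψ * (qt - 2 * (p - 1) * v * (B + X + Rc + Hf))) + a * R * S ≤
      v * ((2 * a + 1) * R * y + (p - 1) * S + ψ' * q + (p - 1) * q
        + ψ * (a * v * y ^ 2 + (p + 2) * vq + 2 * k * q + 2 * Sx + 2 * Sv * q)) + a * R * S := by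
    gcongr
  refine h1.trans ?_
  -- The first-order condition along ∇v replaces ψ·vq. The terms in Ry add up to -aRy, which with
  -- ψavy² leaves -q. The terms in q with coefficient p-1 leave -(p²-1)q, so the total is -p²q: this
  -- is where the constant p² in the weight comes from.
  have h2 : v * ((2 * a + 1) * R * y + (p - 1) * S + ψ' * q + (p - 1) * q
        + ψ * (a * v * y ^ 2 + (p + 2) * vq + 2 * k * q + 2 * Sx + 2 * Sv * q)) + a * R * S
      = v * q * (ψ' + 2 * k * ψ - p ^ 2) + p * v * S + 2 * v * ψ * Sx
        + ψ * q * (2 * v * Sv + a * S) := by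
    have e1 : ψ * vq = -(a * R * y) - (p - 1) * q := by linarith
    have e2 : v * ((2 * a + 1) * R * y + (p - 1) * S + ψ' * q + (p - 1) * q
        + ψ * (a * v * y ^ 2 + (p + 2) * vq + 2 * k * q + 2 * Sx + 2 * Sv * q)) + a * R * S
        = v * ((2 * a + 1) * R * y + (p - 1) * S + ψ' * q + (p - 1) * q
        + ψ * a * v * y ^ 2 + (p + 2) * (ψ * vq) + ψ * (2 * k * q + 2 * Sx + 2 * Sv * q))
        + a * R * S := by ring
    rw [e2, e1, hR, hq]
    linear_combination (-(v * y * (ψ * (v * y) + (p - 1) * v))) * hpa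
      + (v * S - v ^ 2 * y) * hap
  rw [h2]
  have hq0 : 0 ≤ q := by rw [hq]; positivity
  have t1 : v * q * (ψ' + 2 * k * ψ - p ^ 2) ≤ 0 :=
    mul_nonpos_of_nonneg_of_nonpos (by positivity) (by linarith)
  have t2 : p * v * S ≤ 0 := mul_nonpos_of_nonneg_of_nonpos (by positivity) hS
  have t3 : 2 * v * ψ * Sx ≤ 0 := mul_nonpos_of_nonneg_of_nonpos (by positivity) hSx
  have t4 : ψ * q * (2 * v * Sv + a * S) ≤ 0 :=
    mul_nonpos_of_nonneg_of_nonpos (by positivity) hSv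
  linarith

/-! ### The evolution inequality at a spatial maximum, in a chart. -/

section Coordinates

variable {n : ℕ} {U : Set (Model n)} {G : Model n → Matrix (Fin n) (Fin n) ℝ}
  {φ χ h : Model n → ℝ} {z : Model n}

theorem pd_comp_prod {S : Model n → ℝ → ℝ}
    (hS : DifferentiableAt ℝ (fun x : Model n × ℝ => S x.1 x.2) (z, φ z))
    (hφ : DifferentiableAt ℝ φ z) (i : Fin n) :
    pd i (fun y => S y (φ y)) z = pd i (fun y => S y (φ z)) z + deriv (S z) (φ z) * pd i φ z := by
  set A := fderiv ℝ (fun x : Model n × ℝ => S x.1 x.2) (z, φ z) with hA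
  have hSd : HasFDerivAt (fun x : Model n × ℝ => S x.1 x.2) A (z, φ z) := hS.hasFDerivAt
  have h1 : HasFDerivAt (fun y => S y (φ y))
      (A.comp ((ContinuousLinearMap.id ℝ (Model n)).prod (fderiv ℝ φ z))) z :=
    HasFDerivAt.comp (f := fun y => (y, φ y)) z hSd ((hasFDerivAt_id z).prodMk hφ.hasFDerivAt)
  have h2 : HasFDerivAt (fun y => S y (φ z)) (A.comp (ContinuousLinearMap.inl ℝ (Model n) ℝ)) z :=
    HasFDerivAt.comp (f := fun y => (y, φ z)) z hSd (hasFDerivAt_prodMk_left z (φ z))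
  have h3 : HasDerivAt (S z) (A (0, 1)) (φ z) :=
    HasFDerivAt.comp_hasDerivAt (f := fun s => (z, s)) (φ z) hSd
      ((hasDerivAt_const (φ z) z).prodMk (hasDerivAt_id (φ z)))
  unfold pd
  rw [h1.fderiv, h2.fderiv, h3.deriv]
  simp only [ContinuousLinearMap.comp_apply, ContinuousLinearMap.prod_apply,
    ContinuousLinearMap.id_apply, ContinuousLinearMap.inl_apply]
  have : (EuclideanSpace.single i (1 : ℝ), fderiv ℝ φ z (EuclideanSpace.single i 1)) =
      (EuclideanSpace.single i (1 : ℝ), (0 : ℝ))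
        + fderiv ℝ φ z (EuclideanSpace.single i 1) • ((0 : Model n), (1 : ℝ)) := by
    ext <;> simp
  rw [this, map_add, map_smul, smul_eq_mul]
  ring

namespace IsMetricOn

theorem innerCoord_const_mul_add (hG : IsMetricOn U G) (hz : z ∈ U)
    (hh : DifferentiableAt ℝ h z) (hφ : DifferentiableAt ℝ φ z) (χ : Model n → ℝ) (c d : ℝ) :
    innerCoord G χ (fun y => c * h y + d * φ y) z =
      c * innerCoord G χ h z + d * innerCoord G χ φ z := by
  simp only [hG.innerCoord_eq_sum hz, Finset.mul_sum, ← Finset.sum_add_distrib]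
  refine Finset.sum_congr rfl fun i _ => ?_
  rw [pd_add _ (hh.const_mul c) (hφ.const_mul d), pd_const_mul _ _ hh, pd_const_mul _ _ hφ]
  ring

theorem innerCoord_of_pd_eq (hG : IsMetricOn U G) (hz : z ∈ U) {c : ℝ}
    (hh : ∀ i, pd i h z = c * pd i φ z) (χ : Model n → ℝ) :
    innerCoord G χ h z = c * innerCoord G χ φ z := by
  simp only [hG.innerCoord_eq_sum hz, Finset.mul_sum, hh]
  exact Finset.sum_congr rfl fun i _ => by ring

theorem innerCoord_self_nonneg (hG : IsMetricOn U G) (hz : z ∈ U) (φ : Model n → ℝ) :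
    0 ≤ innerCoord G φ φ z := by
  have := (hG.posDef z hz).inv.posSemidef.dotProduct_mulVec_nonneg (fun i => pd i φ z)
  simp only [star_trivial] at this
  exact this

end IsMetricOn

open IsMetricOn in
/-- At a spatial maximum point of `v ^ a * (ψ |∇v|² + (p - 1) v)`, the time derivative of this
quantity cannot be positive. -/
theorem time_deriv_nonpos_of_isLocalMax {T p m k t ψ' : ℝ} (hT : 0 < T) (ht : t ∈ Set.Icc 0 T)
    (hU : IsOpen U) (hz : z ∈ U) (hn : (n : ℝ) ≤ m)
    (hp : 1 < p) (hm : m - 1 ≤ (1 / (p - 1)) ^ 2)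
    {G : ℝ → Model n → Matrix (Fin n) (Fin n) ℝ} {φ : ℝ → Model n → ℝ} {f : Model n → ℝ}
    {S : Model n → ℝ → ℝ} {ψ : ℝ → ℝ}
    (hG : IsMetricOn U (G t))
    (hGt : ∀ i j, ContDiffOn ℝ 1 (fun s => G s z i j) (Set.Icc 0 T))
    (hGpos : ∀ s ∈ Set.Icc 0 T, (G s z).PosDef)
    (hφ : ContDiffOn ℝ ∞ (fun x : Model n × ℝ => φ x.2 x.1) (U ×ˢ Set.Icc 0 T))
    (hφpos : ∀ y ∈ U, 0 < φ t y)
    (hf : ContDiffOn ℝ 2 f U) (hfm : m = n → ∀ i, pd i f z = 0)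
    (hS : ContDiffOn ℝ 1 (fun x : Model n × ℝ => S x.1 x.2) (U ×ˢ Set.Ioi 0))
    (hpde : ∀ y ∈ U, derivWithin (fun s => φ s y) (Set.Icc 0 T) t =
      (p - 1) * φ t y * (laplaceCoord (G t) (φ t) y - innerCoord (G t) f (φ t) y)
        + innerCoord (G t) (φ t) (φ t) y + S y (φ t y))
    (hSz : S z (φ t z) ≤ 0)
    (hSx : innerCoord (G t) (φ t) (fun y => S y (φ t z)) z ≤ 0)
    (hSv : deriv (S z) (φ t z) + S z (φ t z) / (2 * (p - 1) * φ t z) ≤ 0)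
    (hflow : -k * innerCoord (G t) (φ t) (φ t) z ≤
      (1 / 2) * (∑ i, ∑ j, derivWithin (fun s => G s z i j) (Set.Icc 0 T) t
        * gradCoord (G t) (φ t) i z * gradCoord (G t) (φ t) j z)
      + (p - 1) * φ t z *
        ((∑ i, ∑ j, ricciCoord (G t) z i j
          * gradCoord (G t) (φ t) i z * gradCoord (G t) (φ t) j z)
        + (∑ i, ∑ j, hessCoord (G t) f z i j
          * gradCoord (G t) (φ t) i z * gradCoord (G t) (φ t) j z)
        - innerCoord (G t) f (φ t) z ^ 2 / (m - n)))
    (hψ : HasDerivWithinAt ψ ψ' (Set.Icc 0 T) t) (hψ0 : 0 ≤ ψ t)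
    (hψk : ψ' + 2 * k * ψ t ≤ p ^ 2)
    (hmax : IsLocalMax (fun y => φ t y ^ (1 / (p - 1)) *
      (ψ t * innerCoord (G t) (φ t) (φ t) y + (p - 1) * φ t y)) z) :
    ∃ d ≤ 0, HasDerivWithinAt (fun s => φ s z ^ (1 / (p - 1)) *
      (ψ s * innerCoord (G s) (φ s) (φ s) z + (p - 1) * φ s z)) d (Set.Icc 0 T) t := by
  set a := 1 / (p - 1) with ha
  have hb : 0 < p - 1 := by linarith
  have hap : a * (p - 1) = 1 := by rw [ha]; field_simp
  have hu : UniqueDiffWithinAt ℝ (Set.Icc 0 T) t := uniqueDiffOn_Icc hT t ht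
  have hφt : ContDiffOn ℝ ∞ (φ t) U := contDiffOn_slice hφ ht
  have hφ3 : ContDiffOn ℝ 3 (φ t) U := mod_cast contDiffOn_infty.1 hφt 3
  have hφ2 : ContDiffOn ℝ 2 (φ t) U := hφ3.of_le (by norm_num)
  have hq2 : ContDiffOn ℝ 2 (innerCoord (G t) (φ t) (φ t)) U :=
    hG.contDiffOn_innerCoord hφ3 hφ3 (by norm_num) le_rfl
  have hs1 : ContDiffOn ℝ 1 (innerCoord (G t) f (φ t)) U :=
    hG.contDiffOn_innerCoord hf hφ2 (by norm_num) (by norm_num)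
  have hL1 : ContDiffOn ℝ 1 (laplaceCoord (G t) (φ t)) U :=
    ContDiffOn.sum fun i _ => ContDiffOn.sum fun j _ =>
      ((hG.contDiffOn_inv i j).of_le (by norm_num)).mul
        (hG.contDiffOn_hessCoord hφ3 (by norm_num) le_rfl i j)
  have dφ : DifferentiableAt ℝ (φ t) z := differentiableAt_of_contDiffOn hU hφ2 (by norm_num) hz
  have dq : DifferentiableAt ℝ (innerCoord (G t) (φ t) (φ t)) z :=
    differentiableAt_of_contDiffOn hU hq2 (by norm_num) hz
  have dLs : DifferentiableAt ℝ
      (fun y => laplaceCoord (G t) (φ t) y - innerCoord (G t) f (φ t) y) z :=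
    differentiableAt_of_contDiffOn hU (hL1.sub hs1) le_rfl hz
  have hv := hφpos z hz
  have dS : DifferentiableAt ℝ (fun x : Model n × ℝ => S x.1 x.2) (z, φ t z) :=
    (hS.contDiffAt ((hU.prod isOpen_Ioi).mem_nhds
      (⟨hz, hv⟩ : (z, φ t z) ∈ U ×ˢ Set.Ioi (0 : ℝ)))).differentiableAt (by norm_num)
  have dS' : DifferentiableAt ℝ (fun y => S y (φ t y)) z :=
    dS.comp (f := fun y => (y, φ t y)) z (differentiableAt_id.prodMk dφ)
  -- the time derivatives
  have hvt : HasDerivWithinAt (fun s => φ s z) (derivWithin (fun s => φ s z) (Set.Icc 0 T) t)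
      (Set.Icc 0 T) t := ((contDiffOn_time_slice hφ hz).differentiableOn (by simp) t ht).hasDerivWithinAt
  have hbt : ∀ i, HasDerivWithinAt (fun s => pd i (φ s) z)
      (pd i (fun y => derivWithin (fun s => φ s y) (Set.Icc 0 T) t) z) (Set.Icc 0 T) t := fun i =>
    hasDerivWithinAt_pd hU hT (mod_cast contDiffOn_infty.1 hφ 2) hz ht i
  have hqt := hasDerivWithinAt_innerCoord hu ht hGt hGpos hbt
  have hFt := (hvt.rpow_const (p := a) (Or.inl hv.ne')).fun_mul
    ((hψ.fun_mul hqt).fun_add (hvt.const_mul (p - 1)))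
  have hpd : ∀ i, pd i (fun y => derivWithin (fun s => φ s y) (Set.Icc 0 T) t) z =
      (p - 1) * (laplaceCoord (G t) (φ t) z - innerCoord (G t) f (φ t) z) * pd i (φ t) z
      + (p - 1) * φ t z *
        pd i (fun y => laplaceCoord (G t) (φ t) y - innerCoord (G t) f (φ t) y) z
      + pd i (innerCoord (G t) (φ t) (φ t)) z
      + pd i (fun y => S y (φ t z)) z + deriv (S z) (φ t z) * pd i (φ t) z := by
    intro i
    rw [pd_congr hU hz hpde, pd_add _ (((dφ.const_mul _).fun_mul dLs).fun_add dq) dS',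
      pd_add _ ((dφ.const_mul _).fun_mul dLs) dq, pd_mul _ (dφ.const_mul _) dLs,
      pd_const_mul _ _ dφ, pd_comp_prod dS dφ]
    ring
  -- the space derivatives
  set R : Model n → ℝ := fun y => ψ t * innerCoord (G t) (φ t) (φ t) y + (p - 1) * φ t y with hRdef
  have hR2 : ContDiffOn ℝ 2 R U := (contDiffOn_const.mul hq2).add (contDiffOn_const.mul hφ2)
  have hUa2 : ContDiffOn ℝ 2 (fun y => φ t y ^ a) U :=
    hφ2.rpow_const_of_ne fun y hy => (hφpos y hy).ne'
  have dR : DifferentiableAt ℝ R z := differentiableAt_of_contDiffOn hU hR2 (by norm_num) hz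
  have dUa : DifferentiableAt ℝ (fun y => φ t y ^ a) z :=
    differentiableAt_of_contDiffOn hU hUa2 (by norm_num) hz
  have hUpos : 0 < φ t z ^ a := Real.rpow_pos_of_pos hv a
  have e1 : φ t z ^ (a - 1) = φ t z ^ a / φ t z := Real.rpow_sub_one hv.ne' a
  have e2 : φ t z ^ (a - 2) = φ t z ^ a / φ t z ^ 2 := by
    rw [Real.rpow_sub hv]; norm_num
  have hpdU : ∀ i, pd i (fun y => φ t y ^ a) z = (a * (φ t z ^ a / φ t z)) * pd i (φ t) z := by
    intro i
    rw [pd_comp i (θ := fun x => x ^ a) (Real.hasDerivAt_rpow_const (Or.inl hv.ne')) dφ, e1]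
  -- The gradient of v^a R vanishes at the maximum; dividing by v^a expresses ∇R as a multiple of
  -- ∇v.
  have hpdR : ∀ i, pd i R z = (-(a / φ t z * R z)) * pd i (φ t) z := by
    intro i
    have h := pd_eq_zero_of_isLocalMax hmax i
    rw [pd_mul i dUa dR, hpdU] at h
    have h' : φ t z ^ a * (a / φ t z * R z * pd i (φ t) z + pd i R z) = 0 := by
      rw [← h]; ring
    have := (mul_eq_zero.1 h').resolve_left hUpos.ne'
    linarith
  have hlapF := hG.laplaceCoord_nonpos_of_isLocalMax (hUa2.mul hR2) hz hmax
  rw [hG.laplaceCoord_mul hUa2 hR2 hz, hG.laplaceCoord_rpow hφ2 hφpos hz,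
    hG.innerCoord_of_pd_eq hz hpdR, hG.innerCoord_comm hz (fun y => φ t y ^ a),
    hG.innerCoord_of_pd_eq hz hpdU, e1, e2,
    hG.laplaceCoord_add_const_mul hq2 hφ2 hz] at hlapF
  have hgrad : ∀ χ, ψ t * innerCoord (G t) χ (innerCoord (G t) (φ t) (φ t)) z
      + (p - 1) * innerCoord (G t) χ (φ t) z
      = -(a / φ t z * R z) * innerCoord (G t) χ (φ t) z := by
    intro χ
    rw [← hG.innerCoord_const_mul_add hz dq dφ]
    exact hG.innerCoord_of_pd_eq hz hpdR χ
  set v := φ t z with hvdef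
  set q := innerCoord (G t) (φ t) (φ t) z with hqdef
  have hq0 : 0 ≤ q := hG.innerCoord_self_nonneg hz _
  have hqy : q = v * (q / v) := by field_simp
  refine ⟨_, ?_, hFt⟩
  have key := evolution_nonpos (p := p) (m := m) (n := n) (k := k) (a := a) (v := v) (y := q / v)
    (q := q) (R := R z) (ψ := ψ t) (ψ' := ψ') (L := laplaceCoord (G t) (φ t) z)
    (s := innerCoord (G t) f (φ t) z) (σ := innerCoord (G t) f (φ t) z ^ 2 / (m - n))
    (vt := derivWithin (fun s => φ s z) (Set.Icc 0 T) t)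
    (X := ∑ i, gradCoord (G t) (φ t) i z * pd i (fun y => laplaceCoord (G t) (φ t) y
      - innerCoord (G t) f (φ t) y) z)
    (vq := innerCoord (G t) (φ t) (innerCoord (G t) (φ t) (φ t)) z)
    (Sx := innerCoord (G t) (φ t) (fun y => S y (φ t z)) z)
    (Sv := deriv (S z) (φ t z)) (S := S z (φ t z))
    hp hap hm hv (by positivity) hqy rfl hψ0 hψk (hpde z hz) (hqt := ?_)
    (hboch := hG.bochner_drift hφ3 hf hz |>.trans (by ring)) (hflow := hflow)
    (hmat := fun α β => hG.hess_lower_bound hφ2 hz α β) (hσ := ?_) (hgv := ?_) (hgf := ?_)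
    (hlap := ?_) hSz hSx ?_
    (qt := 2 * ∑ i, gradCoord (G t) (φ t) i z *
      pd i (fun y => derivWithin (fun s => φ s y) (Set.Icc 0 T) t) z
        - ∑ i, ∑ j, derivWithin (fun s => G s z i j) (Set.Icc 0 T) t
          * gradCoord (G t) (φ t) i z * gradCoord (G t) (φ t) j z)
  -- The common positive factor v^{a-1} is taken out, since the algebraic inequality concerns only
  -- the bracket.
  · have e3 : ∀ x w r d : ℝ, x * a * v ^ (a - 1) * (r * q + w) + v ^ a * d =
        v ^ a / v * (a * (r * q + w) * x + v * d) := by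
      intro x w r d
      rw [e1]; field_simp
    have := mul_nonpos_of_nonneg_of_nonpos (show 0 ≤ v ^ a / v by positivity) key
    refine le_of_eq_of_le ?_ this
    rw [← e3]
  · congr 2
    simp only [hpd, mul_add, Finset.sum_add_distrib]
    simp only [hqdef, hG.innerCoord_eq_sum hz (φ t), Finset.mul_sum, ← Finset.sum_add_distrib]
    refine Finset.sum_congr rfl fun i _ => by ring
  -- For m = n the potential has no gradient, and the quotient by m - n is 0/0 = 0. Otherwise the
  -- claim is a completed square.
  · rcases hn.eq_or_lt with h | h
    · have hs0 : innerCoord (G t) f (φ t) z = 0 := by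
        simp [innerCoord, hfm h.symm]
      rw [hs0, h]; simp
    · have hmn : 0 < m - n := by linarith
      have : innerCoord (G t) f (φ t) z ^ 2 / (m - n) + q / v * innerCoord (G t) f (φ t) z
          + (m - n) * (q / v) ^ 2 / 4
          = (innerCoord (G t) f (φ t) z + (m - n) * (q / v) / 2) ^ 2 / (m - n) := by
        field_simp; ring
      have h2 : 0 ≤ (innerCoord (G t) f (φ t) z + (m - n) * (q / v) / 2) ^ 2 / (m - n) := by
        positivity
      linarith
  · rw [hgrad]; ring
  · rw [hgrad]; field_simp
  · have h3 : v ^ a / v * (-((a ^ 2 + a) * R z * (q / v)) + a * R z * laplaceCoord (G t) (φ t) z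
        + v * (ψ t * laplaceCoord (G t) (innerCoord (G t) (φ t) (φ t)) z
          + (p - 1) * laplaceCoord (G t) (φ t) z)) ≤ 0 := by
      refine le_of_eq_of_le ?_ hlapF
      field_simp
      ring
    exact nonpos_of_mul_nonpos_right h3 (by positivity)
  · have := mul_nonpos_of_nonneg_of_nonpos (show 0 ≤ 2 * v by positivity) hSv
    refine le_of_eq_of_le ?_ this
    rw [ha, ← hvdef]; field_simp

end Coordinates

/-! ### Passage from the manifold to its charts. -/

section Manifold

variable {n : ℕ} {M : Type*} [TopologicalSpace M] [ChartedSpace (Model n) M]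
  [IsManifold (𝓡 n) ∞ M] {e : OpenPartialHomeomorph M (Model n)} {z : Model n} {T : ℝ}

theorem isManifold_one : IsManifold (𝓡 n) 1 M :=
  IsManifold.of_le (n := ∞) (by exact_mod_cast le_top)

theorem chart_mdifferentiable (he : e ∈ atlas (Model n) M) :
    e.MDifferentiable (𝓡 n) (𝓡 n) :=
  haveI : IsManifold (𝓡 n) 1 M := isManifold_one
  mdifferentiable_of_mem_atlas he

/-! ### Smoothness in a chart -/

theorem contMDiffOn_symm_atlas (he : e ∈ atlas (Model n) M) :
    ContMDiffOn (𝓡 n) (𝓡 n) ∞ e.symm e.target :=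
  contMDiffOn_symm_of_mem_maximalAtlas (IsManifold.subset_maximalAtlas he)

theorem contMDiffOn_symm_prod (he : e ∈ atlas (Model n) M) :
    ContMDiffOn 𝓘(ℝ, Model n × ℝ) ((𝓡 n).prod 𝓘(ℝ, ℝ)) ∞
      (fun x : Model n × ℝ => (e.symm x.1, x.2)) (e.target ×ˢ Set.univ) :=
  ((contMDiffOn_symm_atlas he).comp contDiff_fst.contMDiff.contMDiffOn fun _ hx => hx.1).prodMk
    contDiff_snd.contMDiff.contMDiffOn

theorem contDiffOn_coord {k : WithTop ℕ∞} (hk : k ≤ ∞) {w : M → ℝ → ℝ} {D : Set ℝ}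
    (hw : ContMDiffOn ((𝓡 n).prod 𝓘(ℝ, ℝ)) 𝓘(ℝ, ℝ) k (fun q : M × ℝ => w q.1 q.2)
      (Set.univ ×ˢ D)) (he : e ∈ atlas (Model n) M) :
    ContDiffOn ℝ k (fun x : Model n × ℝ => w (e.symm x.1) x.2) (e.target ×ˢ D) := by
  rw [← contMDiffOn_iff_contDiffOn]
  exact hw.comp (((contMDiffOn_symm_prod he).of_le hk).mono
    (Set.prod_mono_right (Set.subset_univ _))) fun x hx => ⟨trivial, hx.2⟩

/-- The coordinate field is the tangent map of the inverse chart applied to a constant section; one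
derivative of a smooth chart is lost. -/
theorem contMDiffOn_frame (he : e ∈ atlas (Model n) M) (i : Fin n) :
    haveI : IsManifold (𝓡 n) 1 M := isManifold_one
    ContMDiffOn (𝓡 n) (𝓡 n).tangent 2
      (fun y => (⟨e.symm y, frame e i y⟩ : TangentBundle (𝓡 n) M)) e.target := by
  have : IsManifold (𝓡 n) 1 M := isManifold_one
  have h1 := ((contMDiffOn_symm_atlas he).of_le (ENat.LEInfty.out :
    (3 : WithTop ℕ∞) ≤ ∞)).contMDiffOn_tangentMapWithin (m := 2) (by norm_num)
    e.open_target.uniqueMDiffOn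
  have h2 : ContMDiffOn (𝓡 n) (𝓡 n).tangent 2 (fun y : Model n =>
      (⟨y, (EuclideanSpace.single i 1 : Model n)⟩ : TangentBundle (𝓡 n) (Model n))) e.target :=
    contMDiffOn_vectorSpace_iff_contDiffOn.2 contDiffOn_const
  refine (h1.comp h2 fun y hy => hy).congr fun y hy => ?_
  simp only [Function.comp, tangentMapWithin, frame]
  rw [mfderivWithin_of_isOpen e.open_target hy]

theorem contDiffOn_components {g : ℝ → Metric n M} (hg : IsC2MetricFamily T g)
    (he : e ∈ atlas (Model n) M) (i j : Fin n) :
    ContDiffOn ℝ 2 (fun x : Model n × ℝ => components (g x.2) e x.1 i j)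
      (e.target ×ˢ Set.Icc 0 T) := by
  have : IsManifold (𝓡 n) 1 M := isManifold_one
  have hb := ((contMDiffOn_symm_prod he).of_le (ENat.LEInfty.out : (2 : WithTop ℕ∞) ≤ ∞)).mono
    (Set.prod_mono_right (Set.subset_univ (Set.Icc 0 T)))
  have h1 := ContMDiffOn.comp hg hb fun x hx => ⟨trivial, hx.2⟩
  have h2 : ∀ i, ContMDiffOn 𝓘(ℝ, Model n × ℝ) (𝓡 n).tangent 2
      (fun x : Model n × ℝ => (⟨e.symm x.1, frame e i x.1⟩ : TangentBundle (𝓡 n) M))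
      (e.target ×ˢ Set.Icc 0 T) := fun i =>
    (contMDiffOn_frame he i).comp contDiff_fst.contMDiff.contMDiffOn fun x hx => hx.1
  have h3 : ContMDiffOn 𝓘(ℝ, Model n × ℝ) ((𝓡 n).prod 𝓘(ℝ, ℝ)) 2
      (fun x : Model n × ℝ => Bundle.TotalSpace.mk' ℝ (E := Bundle.Trivial M ℝ) (e.symm x.1)
        ((g x.2).inner (e.symm x.1) (frame e i x.1) (frame e j x.1))) (e.target ×ˢ Set.Icc 0 T) :=
    ContMDiffOn.clm_bundle_apply₂ (F₁ := Model n) (F₂ := Model n) h1 (h2 i) (h2 j)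
  rw [← contMDiffOn_iff_contDiffOn]
  intro x hx
  have := h3 x hx
  rw [Bundle.contMDiffWithinAt_totalSpace] at this
  exact this.2

end Manifold

section Manifold

variable {n : ℕ} {M : Type*} [TopologicalSpace M] [ChartedSpace (Model n) M]
  [IsManifold (𝓡 n) ∞ M] {e : OpenPartialHomeomorph M (Model n)} {z : Model n} {T : ℝ}

/-! ### Expressing geometric quantities in a chart -/

theorem inner_grad (g : Metric n M) (w : M → ℝ) (x : M) (Y : TangentSpace (𝓡 n) x) :
    g.inner x (grad g w x) Y = dform w x Y :=
  Classical.choose_spec (existsUnique_riesz g x (dform w x)).exists Y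

theorem gradInner_eq_dform (g : Metric n M) (w₁ w₂ : M → ℝ) (x : M) :
    gradInner g w₁ w₂ x = dform w₁ x (grad g w₂ x) :=
  inner_grad g w₁ x _

theorem coords_frame (he : e ∈ atlas (Model n) M) (hz : z ∈ e.target) (i : Fin n) :
    coords e (e.symm z) (frame e i z) = EuclideanSpace.single i 1 := by
  have h := (chart_mdifferentiable he).comp_symm_deriv hz
  exact DFunLike.congr_fun h (EuclideanSpace.single i 1 : Model n)

theorem eq_sum_frame (he : e ∈ atlas (Model n) M) (hz : z ∈ e.target)
    (X : TangentSpace (𝓡 n) (e.symm z)) :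
    X = ∑ i, coords e (e.symm z) X i • frame e i z := by
  have h := (chart_mdifferentiable he).symm_comp_deriv (e.map_target hz)
  have h' : mfderiv (𝓡 n) (𝓡 n) e.symm (e (e.symm z))
      (mfderiv (𝓡 n) (𝓡 n) e (e.symm z) X) = X := DFunLike.congr_fun h X
  rw [e.right_inv hz] at h'
  have hc : ∀ c : Model n, c = ∑ i, c i • (EuclideanSpace.single i (1 : ℝ) : Model n) := by
    intro c; ext j; simp [Finset.sum_apply, Pi.single_apply]
  have h2 : ∀ c : Model n, mfderiv (𝓡 n) (𝓡 n) e.symm z c = ∑ i, c i • frame e i z := by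
    intro c
    conv_lhs => rw [hc c]
    erw [map_sum]
    refine Finset.sum_congr rfl fun i _ => ?_
    exact map_smul (mfderiv (𝓡 n) (𝓡 n) e.symm z) (c i) _
  exact h'.symm.trans (h2 _)

theorem dform_frame (he : e ∈ atlas (Model n) M) (hz : z ∈ e.target) {w : M → ℝ}
    (hw : MDifferentiableAt (𝓡 n) 𝓘(ℝ, ℝ) w (e.symm z)) (i : Fin n) :
    dform w (e.symm z) (frame e i z) = pd i (w ∘ e.symm) z := by
  have h := mfderiv_comp z hw ((chart_mdifferentiable he).mdifferentiableAt_symm hz)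
  rw [mfderiv_eq_fderiv] at h
  exact (DFunLike.congr_fun h (EuclideanSpace.single i 1 : Model n)).symm

theorem dform_eq_sum (he : e ∈ atlas (Model n) M) (hz : z ∈ e.target) {w : M → ℝ}
    (hw : MDifferentiableAt (𝓡 n) 𝓘(ℝ, ℝ) w (e.symm z)) (X : TangentSpace (𝓡 n) (e.symm z)) :
    dform w (e.symm z) X = ∑ i, pd i (w ∘ e.symm) z * coords e (e.symm z) X i := by
  conv_lhs => rw [eq_sum_frame he hz X]
  rw [map_sum]
  refine Finset.sum_congr rfl fun i _ => ?_
  rw [map_smul, dform_frame he hz hw, smul_eq_mul, mul_comm]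

theorem inner_eq_sum (g : Metric n M) (he : e ∈ atlas (Model n) M) (hz : z ∈ e.target)
    (X Y : TangentSpace (𝓡 n) (e.symm z)) :
    g.inner (e.symm z) X Y = ∑ i, ∑ j, components g e z i j * coords e (e.symm z) X i
      * coords e (e.symm z) Y j := by
  conv_lhs => rw [eq_sum_frame he hz X, eq_sum_frame he hz Y]
  simp only [map_sum, map_smul, sum_apply, smul_apply,
    smul_eq_mul, Finset.mul_sum]
  rw [Finset.sum_comm]
  refine Finset.sum_congr rfl fun i _ => Finset.sum_congr rfl fun j _ => ?_
  simp only [components, Matrix.of_apply]; ring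

theorem isMetricOn_components (g : Metric n M) (he : e ∈ atlas (Model n) M) :
    IsMetricOn e.target (components g e) where
  isOpen := e.open_target
  contDiffOn i j := by
    -- A single metric is a constant family in time, so the space-time statement, sliced at time 0,
    -- gives its regularity.
    have h : IsC2MetricFamily (1 : ℝ) (fun _ : ℝ => g) :=
      (g.contMDiff.comp contMDiff_fst).contMDiffOn
    exact contDiffOn_slice (contDiffOn_components h he i j) (by norm_num : (0 : ℝ) ∈ Set.Icc 0 1)
  posDef z hz := by
    refine Matrix.PosDef.of_dotProduct_mulVec_pos ?_ fun c hc => ?_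
    · ext i j
      simp [components, g.symm]
    · set X : TangentSpace (𝓡 n) (e.symm z) := ∑ i, c i • frame e i z with hX
      have hcX : coords e (e.symm z) X = WithLp.toLp 2 c := by
        have : coords e (e.symm z) X = ∑ i, c i • coords e (e.symm z) (frame e i z) := by
          rw [hX]
          unfold coords
          erw [map_sum]
          exact Finset.sum_congr rfl fun i _ => map_smul (mfderiv (𝓡 n) (𝓡 n) e (e.symm z)) (c i) _
        rw [this]
        simp only [coords_frame he hz]
        ext j; simp [Finset.sum_apply, Pi.single_apply]
      have hX0 : X ≠ 0 := by
        intro h0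
        apply hc
        have h1 : coords e (e.symm z) X = 0 := by
          rw [h0]; exact map_zero (mfderiv (𝓡 n) (𝓡 n) e (e.symm z))
        rw [hcX] at h1
        ext j
        exact congrArg (fun d : Model n => d j) h1
      have := g.pos _ X hX0
      rw [inner_eq_sum g he hz, hcX] at this
      simp only [star_trivial, dotProduct, Matrix.mulVec, Finset.mul_sum]
      refine this.trans_eq ?_
      exact Finset.sum_congr rfl fun i _ => Finset.sum_congr rfl fun j _ => by ring

/-- Testing the defining property of the gradient on the coordinate fields gives G times its
coordinates; inverting G finishes. -/
theorem coords_grad (g : Metric n M) (he : e ∈ atlas (Model n) M) (hz : z ∈ e.target) {w : M → ℝ}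
    (hw : MDifferentiableAt (𝓡 n) 𝓘(ℝ, ℝ) w (e.symm z)) (i : Fin n) :
    coords e (e.symm z) (grad g w (e.symm z)) i = gradCoord (components g e) (w ∘ e.symm) i z := by
  have hG := isMetricOn_components g he
  have h : ∀ j, ∑ k, components g e z j k * coords e (e.symm z) (grad g w (e.symm z)) k
      = pd j (w ∘ e.symm) z := by
    intro j
    rw [← dform_frame he hz hw j, ← inner_grad g, inner_eq_sum g he hz, coords_frame he hz]
    refine Finset.sum_congr rfl fun k _ => ?_
    rw [hG.symm hz j k]
    simp
  unfold gradCoord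
  simp only [← h]
  exact (hG.sum_inv_mul hz (fun k => coords e (e.symm z) (grad g w (e.symm z)) k) i).symm

theorem dform_grad (g : Metric n M) (he : e ∈ atlas (Model n) M) (hz : z ∈ e.target)
    {w₁ w₂ : M → ℝ} (h₁ : MDifferentiableAt (𝓡 n) 𝓘(ℝ, ℝ) w₁ (e.symm z))
    (h₂ : MDifferentiableAt (𝓡 n) 𝓘(ℝ, ℝ) w₂ (e.symm z)) :
    dform w₁ (e.symm z) (grad g w₂ (e.symm z)) =
      innerCoord (components g e) (w₁ ∘ e.symm) (w₂ ∘ e.symm) z := by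
  rw [dform_eq_sum he hz h₁]
  simp only [coords_grad g he hz h₂]
  rfl

theorem gradInner_eq_innerCoord (g : Metric n M) (he : e ∈ atlas (Model n) M) (hz : z ∈ e.target)
    {w₁ w₂ : M → ℝ} (h₁ : MDifferentiableAt (𝓡 n) 𝓘(ℝ, ℝ) w₁ (e.symm z))
    (h₂ : MDifferentiableAt (𝓡 n) 𝓘(ℝ, ℝ) w₂ (e.symm z)) :
    gradInner g w₁ w₂ (e.symm z) =
      innerCoord (components g e) (w₁ ∘ e.symm) (w₂ ∘ e.symm) z := by
  rw [gradInner_eq_dform, dform_grad g he hz h₁ h₂]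

theorem bakryEmery_grad (m : ℝ) (g : Metric n M) {f w : M → ℝ} (he : e ∈ atlas (Model n) M)
    (hz : z ∈ e.target) (hf : MDifferentiableAt (𝓡 n) 𝓘(ℝ, ℝ) f (e.symm z))
    (hw : MDifferentiableAt (𝓡 n) 𝓘(ℝ, ℝ) w (e.symm z)) :
    bakryEmery m g f e (e.symm z) (grad g w (e.symm z)) (grad g w (e.symm z)) =
      (∑ i, ∑ j, ricciCoord (components g e) z i j * gradCoord (components g e) (w ∘ e.symm) i z
        * gradCoord (components g e) (w ∘ e.symm) j z)
      + (∑ i, ∑ j, hessCoord (components g e) (f ∘ e.symm) z i j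
        * gradCoord (components g e) (w ∘ e.symm) i z
        * gradCoord (components g e) (w ∘ e.symm) j z)
      - innerCoord (components g e) (f ∘ e.symm) (w ∘ e.symm) z ^ 2 / (m - n) := by
  simp only [bakryEmery, ricci, hess, dform_grad g he hz hf hw, coords_grad g he hz hw,
    e.right_inv hz]
  rw [pow_two]

theorem derivWithin_inner_self {g : ℝ → Metric n M} (hT : 0 < T) (hg : IsC2MetricFamily T g)
    (he : e ∈ atlas (Model n) M) (hz : z ∈ e.target) {t : ℝ} (ht : t ∈ Set.Icc 0 T)
    (X : TangentSpace (𝓡 n) (e.symm z)) :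
    derivWithin (fun s => (g s).inner (e.symm z) X X) (Set.Icc 0 T) t =
      ∑ i, ∑ j, derivWithin (fun s => components (g s) e z i j) (Set.Icc 0 T) t
        * coords e (e.symm z) X i * coords e (e.symm z) X j := by
  have hd : ∀ i j, HasDerivWithinAt (fun s => components (g s) e z i j)
      (derivWithin (fun s => components (g s) e z i j) (Set.Icc 0 T) t) (Set.Icc 0 T) t :=
    fun i j => ((contDiffOn_time_slice (contDiffOn_components hg he i j) hz).differentiableOn
      (by norm_num) t ht).hasDerivWithinAt
  simp only [inner_eq_sum _ he hz]
  exact (HasDerivWithinAt.fun_sum fun i _ => HasDerivWithinAt.fun_sum fun j _ =>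
    ((hd i j).mul_const _).mul_const _).derivWithin (uniqueDiffOn_Icc hT t ht)

end Manifold

/-! ### The pressure equation -/

section Pressure

variable {M : Type*} {p t : ℝ}

theorem pressure_pos (hp : 1 < p) {u : ℝ → M → ℝ} {x : M} (hu : 0 < u t x) :
    0 < pressure p u t x := by
  have : 0 < p - 1 := by linarith
  unfold pressure
  positivity

/-- Here (p-1)v/p = u^{p-1}, so the two exponents in Σ recover u^{p-2} and u: Σ is the factor dv/du
= p u^{p-2} times the source term. -/
theorem sigma_pressure (hp : 1 < p) (nl : ℝ → M → ℝ → ℝ) {u : ℝ → M → ℝ} {x : M}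
    (hu : 0 < u t x) :
    sigma p nl t x (pressure p u t x) = p * u t x ^ (p - 2) * nl t x (u t x) := by
  have hb : p - 1 ≠ 0 := by linarith
  have h1 : (p - 1) * pressure p u t x / p = u t x ^ (p - 1) := by
    unfold pressure; field_simp
  unfold sigma
  rw [h1, ← Real.rpow_mul hu.le, ← Real.rpow_mul hu.le, mul_div_cancel₀ _ hb,
    mul_one_div_cancel hb, Real.rpow_one]

end Pressure

/-! ### Regularity of the pressure and of Σ. -/

section SpaceTimeSmoothness

variable {n : ℕ} {M : Type*} [TopologicalSpace M] [ChartedSpace (Model n) M] {T p t : ℝ}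

theorem IsCrOnSpaceTime.contMDiff {k : WithTop ℕ∞} {w : ℝ → M → ℝ} (hw : IsCrOnSpaceTime n k T w)
    (ht : t ∈ Set.Icc 0 T) : ContMDiff (𝓡 n) 𝓘(ℝ, ℝ) k (w t) := by
  have h : ContMDiff (𝓡 n) ((𝓡 n).prod 𝓘(ℝ, ℝ)) k (fun x : M => (x, t)) :=
    contMDiff_id.prodMk contMDiff_const
  rw [← contMDiffOn_univ] at h ⊢
  exact ContMDiffOn.comp (g := fun q : M × ℝ => w q.2 q.1) (f := fun x => (x, t)) hw h
    fun x _ => ⟨trivial, ht⟩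

theorem IsCrOnSpaceTime.pressure {u : ℝ → M → ℝ} (hu : IsCrOnSpaceTime n ∞ T u)
    (hpos : ∀ t ∈ Set.Icc 0 T, ∀ x, 0 < u t x) : IsCrOnSpaceTime n ∞ T (pressure p u) := by
  have h : ContDiffOn ℝ ∞ (fun r : ℝ => p * r ^ (p - 1) / (p - 1)) (Set.Ioi 0) :=
    (contDiffOn_const.mul (contDiffOn_id.rpow_const_of_ne fun r hr => (ne_of_gt hr))).div_const _
  exact ContMDiffOn.comp h.contMDiffOn hu fun x hx => hpos x.2 hx.2 x.1

theorem contMDiffOn_sigma {nl : ℝ → M → ℝ → ℝ} (hp : 1 < p)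
    (hnl : ContMDiffOn ((𝓡 n).prod 𝓘(ℝ, ℝ)) 𝓘(ℝ, ℝ) 1
      (fun q : M × ℝ => nl t q.1 q.2) (Set.univ ×ˢ Set.Ioi 0)) :
    ContMDiffOn ((𝓡 n).prod 𝓘(ℝ, ℝ)) 𝓘(ℝ, ℝ) 1
      (fun q : M × ℝ => sigma p nl t q.1 q.2) (Set.univ ×ˢ Set.Ioi 0) := by
  have hb : 0 < p - 1 := by linarith
  have hpos : ∀ r ∈ Set.Ioi (0 : ℝ), 0 < (p - 1) * r / p := fun r hr => by
    have : (0 : ℝ) < r := hr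
    positivity
  have h : ∀ c : ℝ, ContDiffOn ℝ 1 (fun r : ℝ => ((p - 1) * r / p) ^ c) (Set.Ioi 0) := fun c =>
    ((contDiffOn_const.mul contDiffOn_id).div_const _).rpow_const_of_ne
      fun r hr => (hpos r hr).ne'
  have hsnd : ContMDiffOn ((𝓡 n).prod 𝓘(ℝ, ℝ)) 𝓘(ℝ, ℝ) 1 (fun q : M × ℝ => q.2)
      (Set.univ ×ˢ Set.Ioi 0) := contMDiff_snd.contMDiffOn
  have h' : ∀ c : ℝ, ContMDiffOn ((𝓡 n).prod 𝓘(ℝ, ℝ)) 𝓘(ℝ, ℝ) 1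
      (fun q : M × ℝ => ((p - 1) * q.2 / p) ^ c) (Set.univ ×ˢ Set.Ioi 0) := fun c =>
    (h c).contMDiffOn.comp hsnd fun q hq => hq.2
  have h1 : ContMDiffOn ((𝓡 n).prod 𝓘(ℝ, ℝ)) ((𝓡 n).prod 𝓘(ℝ, ℝ)) 1
      (fun q : M × ℝ => (q.1, ((p - 1) * q.2 / p) ^ (1 / (p - 1)))) (Set.univ ×ˢ Set.Ioi 0) :=
    contMDiff_fst.contMDiffOn.prodMk (h' _)
  have h2 := hnl.comp h1 fun q hq => ⟨trivial, Real.rpow_pos_of_pos (hpos q.2 hq.2) _⟩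
  exact (contMDiffOn_const.mul (h' _)).mul h2

end SpaceTimeSmoothness

section Manifold

variable {n : ℕ} {M : Type*} [TopologicalSpace M] [ChartedSpace (Model n) M]
  [IsManifold (𝓡 n) ∞ M] {e : OpenPartialHomeomorph M (Model n)} {z : Model n} {T p t : ℝ}

theorem IsCrOnSpaceTime.contDiffOn_coord {k : WithTop ℕ∞} (hk : k ≤ ∞) {w : ℝ → M → ℝ}
    (hw : IsCrOnSpaceTime n k T w) (he : e ∈ atlas (Model n) M) :
    ContDiffOn ℝ k (fun x : Model n × ℝ => w x.2 (e.symm x.1)) (e.target ×ˢ Set.Icc 0 T) :=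
  NPME.contDiffOn_coord (w := fun x s => w s x) hk hw he

/-- The equation for u is multiplied by p u^{p-2}. Since d(u^p) = u dv, the diffusion term is uΔ_f v
+ ⟨∇u,∇v⟩, and p u^{p-2}∇u = ∇v turns the last product into |∇v|². -/
theorem pressure_equation {g : ℝ → Metric n M} {f : ℝ → M → ℝ} {nl : ℝ → M → ℝ → ℝ}
    {u : ℝ → M → ℝ} (hp : 1 < p) (hT : 0 < T) (hf : IsCrOnSpaceTime n 2 T f)
    (hu : IsPositiveSmoothSolution T p g f nl u) (ht : t ∈ Set.Ioc 0 T)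
    (he : e ∈ atlas (Model n) M) (hz : z ∈ e.target) :
    derivWithin (fun s => pressure p u s (e.symm z)) (Set.Icc 0 T) t =
      (p - 1) * pressure p u t (e.symm z) *
        (laplaceCoord (components (g t) e) (pressure p u t ∘ e.symm) z
          - innerCoord (components (g t) e) (f t ∘ e.symm) (pressure p u t ∘ e.symm) z)
        + innerCoord (components (g t) e) (pressure p u t ∘ e.symm) (pressure p u t ∘ e.symm) z
        + sigma p nl t (e.symm z) (pressure p u t (e.symm z)) := by
  have ht' : t ∈ Set.Icc 0 T := Set.Ioc_subset_Icc_self ht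
  have hb : p - 1 ≠ 0 := by linarith
  have hG := isMetricOn_components (g t) he
  set μ : Model n → ℝ := fun y => u t (e.symm y) with hμ
  have hμpos : ∀ y, 0 < μ y := fun y => hu.pos t ht' _
  have hμs : ContDiffOn ℝ ∞ μ e.target :=
    contDiffOn_slice (hu.smooth.contDiffOn_coord le_rfl he) ht'
  have hμ2 : ContDiffOn ℝ 2 μ e.target := hμs.of_le ENat.LEInfty.out
  have hφ2 : ContDiffOn ℝ 2 (pressure p u t ∘ e.symm) e.target :=
    (contDiffOn_slice ((hu.smooth.pressure hu.pos).contDiffOn_coord le_rfl he) ht').of_le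
      ENat.LEInfty.out
  have dμ : ∀ y ∈ e.target, DifferentiableAt ℝ μ y := fun y hy =>
    differentiableAt_of_contDiffOn e.open_target hμ2 (by norm_num) hy
  have hpdφ : ∀ y ∈ e.target, ∀ j, pd j (pressure p u t ∘ e.symm) y =
      (p * μ y ^ (p - 2)) * pd j μ y := by
    intro y hy j
    have h := pd_comp j (((Real.hasDerivAt_rpow_const (p := p - 1)
      (Or.inl (hμpos y).ne')).const_mul p).div_const (p - 1)) (dμ y hy)
    refine Eq.trans h ?_
    rw [show p - 1 - 1 = p - 2 by ring]
    field_simp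
  have hpow : ∀ y, μ y ^ (p - 1) = μ y * μ y ^ (p - 2) := fun y => by
    rw [show p - 1 = 1 + (p - 2) by ring, Real.rpow_add (hμpos y), Real.rpow_one]
  have hpdp : ∀ y ∈ e.target, ∀ j, pd j ((fun x => u t x ^ p) ∘ e.symm) y =
      μ y * pd j (pressure p u t ∘ e.symm) y := by
    intro y hy j
    have h := pd_comp j (Real.hasDerivAt_rpow_const (p := p) (Or.inl (hμpos y).ne')) (dμ y hy)
    refine Eq.trans h ?_
    rw [hpdφ y hy, hpow]; ring
  have hmu : MDifferentiableAt (𝓡 n) 𝓘(ℝ, ℝ) (u t) (e.symm z) :=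
    (hu.smooth.contMDiff ht').mdifferentiable (by simp) _
  have hmf : MDifferentiableAt (𝓡 n) 𝓘(ℝ, ℝ) (f t) (e.symm z) :=
    (hf.contMDiff ht').mdifferentiable (by simp) _
  have hmup : MDifferentiableAt (𝓡 n) 𝓘(ℝ, ℝ) (fun x => u t x ^ p) (e.symm z) :=
    MDifferentiableAt.comp (g := fun r : ℝ => r ^ p) (e.symm z)
      ((Real.differentiableAt_rpow_const_of_ne p (hμpos z).ne').mdifferentiableAt) hmu
  have heq := hu.equation t ht e he (e.symm z) (e.map_target hz)
  rw [fLaplacian, e.right_inv hz, gradInner_eq_innerCoord _ he hz hmf hmup,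
    hG.laplaceCoord_of_pd_eq hφ2 (hμ2.of_le (by norm_num)) hz hpdp,
    hG.innerCoord_of_pd_eq hz (hpdp z hz)] at heq
  rw [sigma_pressure hp nl (hu.pos t ht' _), ← heq]
  have hq : innerCoord (components (g t) e) (pressure p u t ∘ e.symm) (pressure p u t ∘ e.symm) z
      = (p * μ z ^ (p - 2)) * innerCoord (components (g t) e) μ (pressure p u t ∘ e.symm) z := by
    rw [hG.innerCoord_of_pd_eq hz (hpdφ z hz), hG.innerCoord_comm hz _ μ]
  have hut : HasDerivWithinAt (fun s => u s (e.symm z))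
      (derivWithin (fun s => u s (e.symm z)) (Set.Icc 0 T) t) (Set.Icc 0 T) t :=
    ((contDiffOn_time_slice (hu.smooth.contDiffOn_coord le_rfl he) hz).differentiableOn
      (by simp) t ht').hasDerivWithinAt
  have hvt := (((hut.rpow_const (p := p - 1) (Or.inl (hμpos z).ne')).const_mul p).div_const
    (p - 1)).derivWithin (uniqueDiffOn_Icc hT t ht')
  refine Eq.trans hvt ?_
  have hφz : (p - 1) * pressure p u t (e.symm z) = p * μ z ^ (p - 2) * μ z := by
    have : pressure p u t (e.symm z) = p * μ z ^ (p - 1) / (p - 1) := rfl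
    rw [this, hpow]; field_simp
  rw [hq, hφz, show p - 1 - 1 = p - 2 by ring]
  change p * (_ * (p - 1) * μ z ^ (p - 2)) / (p - 1) = _
  change _ = _ + _ + p * μ z ^ (p - 2) * _
  field_simp
  ring

/-! ### Continuity in space-time -/

/-- Continuity is local, and in a chart the quantity is polynomial in g⁻¹ and in the spatial
derivatives of v, all continuous in space-time. -/
theorem continuousOn_gradInner (hT : 0 < T) {g : ℝ → Metric n M} (hg : IsC2MetricFamily T g)
    {v : ℝ → M → ℝ} (hv : IsCrOnSpaceTime n ∞ T v) :
    ContinuousOn (fun q : M × ℝ => gradInner (g q.2) (v q.2) (v q.2) q.1)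
      (Set.univ ×ˢ Set.Icc 0 T) := by
  rintro ⟨x, t⟩ ⟨-, ht⟩
  set e := chartAt (Model n) x with he'
  have he : e ∈ atlas (Model n) M := chart_mem_atlas _ x
  have hx : x ∈ e.source := mem_chart_source _ x
  have hpd : ∀ i, ContinuousOn (fun q : Model n × ℝ => pd i (v q.2 ∘ e.symm) q.1)
      (e.target ×ˢ Set.Icc 0 T) := fun i =>
    continuousOn_pd e.open_target hT ((hv.contDiffOn_coord le_rfl he).of_le ENat.LEInfty.out) i
  have hP : ∀ i j, ContinuousOn (fun q : Model n × ℝ => (components (g q.2) e q.1)⁻¹ i j)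
      (e.target ×ˢ Set.Icc 0 T) := fun i j =>
    (contDiffOn_inv_entry (G := fun q : Model n × ℝ => components (g q.2) e q.1)
      (contDiffOn_components hg he)
      (fun q hq => (isMetricOn_components (g q.2) he).det_ne_zero q.1 hq.1) i j).continuousOn
  have hI : ContinuousOn (fun q : Model n × ℝ =>
      innerCoord (components (g q.2) e) (v q.2 ∘ e.symm) (v q.2 ∘ e.symm) q.1)
      (e.target ×ˢ Set.Icc 0 T) :=
    continuousOn_finsetSum _ fun i _ => (hpd i).mul
      (continuousOn_finsetSum _ fun j _ => (hP i j).mul (hpd j))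
  have hc : ContinuousOn (fun q : M × ℝ => (e q.1, q.2)) (e.source ×ˢ Set.Icc 0 T) :=
    (e.continuousOn.comp continuousOn_fst fun q hq => hq.1).prodMk continuousOn_snd
  have h := hI.comp hc fun q hq => ⟨e.map_source hq.1, hq.2⟩
  have h2 : ContinuousOn (fun q : M × ℝ => gradInner (g q.2) (v q.2) (v q.2) q.1)
      (e.source ×ˢ Set.Icc 0 T) := by
    refine h.congr fun q hq => ?_
    have hd : MDifferentiableAt (𝓡 n) 𝓘(ℝ, ℝ) (v q.2) (e.symm (e q.1)) :=
      (hv.contMDiff hq.2).mdifferentiable (by simp) _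
    have := gradInner_eq_innerCoord (g q.2) he (e.map_source hq.1) hd hd
    rw [e.left_inv hq.1] at this
    exact this
  refine (h2 (x, t) ⟨hx, ht⟩).mono_of_mem_nhdsWithin ?_
  rw [mem_nhdsWithin]
  exact ⟨e.source ×ˢ Set.univ, e.open_source.prod isOpen_univ, ⟨hx, trivial⟩,
    fun q hq => ⟨hq.1.1, hq.2.2⟩⟩

end Manifold

/-- Only the direction back towards time 0 is used, so the final time t = T is covered. -/
theorem nonneg_of_hasDerivWithinAt_of_isMaxOn {c : ℝ → ℝ} {d T t : ℝ} (ht : t ∈ Set.Ioc 0 T)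
    (hc : HasDerivWithinAt c d (Set.Icc 0 T) t) (hmax : IsMaxOn c (Set.Icc 0 T) t) : 0 ≤ d := by
  have hseg : segment ℝ t 0 ⊆ Set.Icc 0 T :=
    (convex_Icc 0 T).segment_subset ⟨ht.1.le, ht.2⟩ ⟨le_rfl, ht.1.le.trans ht.2⟩
  have h := hmax.localize.hasFDerivWithinAt_nonpos hc.hasFDerivWithinAt
    (sub_mem_posTangentConeAt_of_segment_subset hseg)
  have h' : (0 - t) * d ≤ 0 := by simpa using h
  nlinarith [ht.1]

/-! ### The maximum principle for the Hamilton quantity. -/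

section Manifold

variable {n : ℕ} {M : Type*} [TopologicalSpace M] [ChartedSpace (Model n) M]
  [IsManifold (𝓡 n) ∞ M] {T p : ℝ}

/-- The quantity to which the maximum principle is applied. -/
def hamiltonQuantity (p : ℝ) (ψ : ℝ → ℝ) (g : ℝ → Metric n M) (v : ℝ → M → ℝ) (t : ℝ) (x : M) :
    ℝ :=
  v t x ^ (1 / (p - 1)) * (ψ t * gradInner (g t) (v t) (v t) x + (p - 1) * v t x)

theorem continuousOn_hamiltonQuantity (hT : 0 < T) {g : ℝ → Metric n M}
    (hg : IsC2MetricFamily T g) {v : ℝ → M → ℝ} (hv : IsCrOnSpaceTime n ∞ T v)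
    (hpos : ∀ t ∈ Set.Icc 0 T, ∀ x, 0 < v t x) {ψ : ℝ → ℝ} (hψ : ContinuousOn ψ (Set.Icc 0 T)) :
    ContinuousOn (fun q : M × ℝ => hamiltonQuantity p ψ g v q.2 q.1)
      (Set.univ ×ˢ Set.Icc 0 T) := by
  have hvc : ContinuousOn (fun q : M × ℝ => v q.2 q.1) (Set.univ ×ˢ Set.Icc 0 T) :=
    ContMDiffOn.continuousOn hv
  have hψc : ContinuousOn (fun q : M × ℝ => ψ q.2) (Set.univ ×ˢ Set.Icc 0 T) :=
    hψ.comp continuousOn_snd fun q hq => hq.2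
  exact (hvc.rpow_const fun q hq => Or.inl (hpos q.2 hq.2 q.1).ne').mul
    ((hψc.mul (continuousOn_gradInner hT hg hv)).add (continuousOn_const.mul hvc))

/-- At a spatial maximum point at a positive time, the time derivative of the Hamilton quantity of
the pressure is nonpositive. -/
theorem hamiltonQuantity_time_deriv_nonpos {m k t ψ' : ℝ} {ψ : ℝ → ℝ} {x : M} (hT : 0 < T)
    (ht : t ∈ Set.Ioc 0 T) (hm : (n : ℝ) ≤ m) (hp : 1 < p) (hpm : m - 1 ≤ (1 / (p - 1)) ^ 2)
    {g : ℝ → Metric n M} (hg : IsC2MetricFamily T g)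
    {f : ℝ → M → ℝ} (hf : IsCrOnSpaceTime n 2 T f)
    (hfm : m = n → ∀ t ∈ Set.Icc 0 T, ∀ x y : M, f t x = f t y)
    {nl : ℝ → M → ℝ → ℝ}
    (hnl : ∀ t ∈ Set.Ioc 0 T, ContMDiffOn ((𝓡 n).prod 𝓘(ℝ, ℝ)) 𝓘(ℝ, ℝ) 1
      (fun q : M × ℝ => nl t q.1 q.2) (Set.univ ×ˢ Set.Ioi 0))
    {u : ℝ → M → ℝ} (hu : IsPositiveSmoothSolution T p g f nl u)
    (hflow : SuperFlow T p m k g f (pressure p u))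
    (hS : sigma p nl t x (pressure p u t x) ≤ 0)
    (hSx : gradInner (g t) (pressure p u t) (fun y => sigma p nl t y (pressure p u t x)) x ≤ 0)
    (hSv : deriv (fun s => sigma p nl t x s) (pressure p u t x)
        + sigma p nl t x (pressure p u t x) / (2 * (p - 1) * pressure p u t x) ≤ 0)
    (hψ : HasDerivWithinAt ψ ψ' (Set.Icc 0 T) t) (hψ0 : 0 ≤ ψ t)
    (hψk : ψ' + 2 * k * ψ t ≤ p ^ 2)
    (hmax : ∀ y, hamiltonQuantity p ψ g (pressure p u) t y
      ≤ hamiltonQuantity p ψ g (pressure p u) t x) :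
    ∃ d ≤ 0, HasDerivWithinAt (fun s => hamiltonQuantity p ψ g (pressure p u) s x) d
      (Set.Icc 0 T) t := by
  have ht' : t ∈ Set.Icc 0 T := Set.Ioc_subset_Icc_self ht
  set v := pressure p u with hvdef
  have hv : IsCrOnSpaceTime n ∞ T v := hu.smooth.pressure hu.pos
  have hvpos : ∀ s ∈ Set.Icc 0 T, ∀ y, 0 < v s y := fun s hs y => pressure_pos hp (hu.pos s hs y)
  obtain ⟨e, he, hx⟩ : ∃ e ∈ atlas (Model n) M, x ∈ e.source :=
    ⟨chartAt _ x, chart_mem_atlas _ x, mem_chart_source _ x⟩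
  obtain ⟨z, hz, rfl⟩ : ∃ z ∈ e.target, e.symm z = x := ⟨e x, e.map_source hx, e.left_inv hx⟩
  have hG := fun s => isMetricOn_components (g s) he
  have hmv : ∀ s ∈ Set.Icc 0 T, ∀ y, MDifferentiableAt (𝓡 n) 𝓘(ℝ, ℝ) (v s) y := fun s hs y =>
    (hv.contMDiff hs).mdifferentiable (by simp) y
  have hmf : MDifferentiableAt (𝓡 n) 𝓘(ℝ, ℝ) (f t) (e.symm z) :=
    (hf.contMDiff ht').mdifferentiable (by simp) _
  have hσ := contMDiffOn_sigma hp (hnl t ht)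
  have hmσ : MDifferentiableAt (𝓡 n) 𝓘(ℝ, ℝ) (fun y => sigma p nl t y (v t (e.symm z)))
      (e.symm z) := by
    have h : ContMDiff (𝓡 n) ((𝓡 n).prod 𝓘(ℝ, ℝ)) 1 (fun y : M => (y, v t (e.symm z))) :=
      contMDiff_id.prodMk contMDiff_const
    have h2 := hσ.comp (h.contMDiffOn (s := Set.univ)) fun y _ => ⟨trivial, hvpos t ht' _⟩
    exact (contMDiffOn_univ.1 h2).mdifferentiable (by simp) _
  have hq : ∀ s ∈ Set.Icc 0 T, ∀ y ∈ e.target, hamiltonQuantity p ψ g v s (e.symm y) =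
      (v s ∘ e.symm) y ^ (1 / (p - 1)) * (ψ s * innerCoord (components (g s) e) (v s ∘ e.symm)
        (v s ∘ e.symm) y + (p - 1) * (v s ∘ e.symm) y) := by
    intro s hs y hy
    rw [hamiltonQuantity, gradInner_eq_innerCoord (g s) he hy (hmv s hs _) (hmv s hs _)]
    rfl
  -- The super flow inequality is needed only on the vector ∇v.
  have hfl := hflow t ht e he (e.symm z) (e.map_target hz) (grad (g t) (v t) (e.symm z))
  rw [bakryEmery_grad m (g t) he hz hmf (hmv t ht' _),
    derivWithin_inner_self hT hg he hz ht' _] at hfl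
  simp only [coords_grad (g t) he hz (hmv t ht' _)] at hfl
  change -k * gradInner (g t) (v t) (v t) (e.symm z) ≤ _ at hfl
  rw [gradInner_eq_innerCoord (g t) he hz (hmv t ht' _) (hmv t ht' _)] at hfl
  rw [gradInner_eq_innerCoord (g t) he hz (hmv t ht' _) hmσ] at hSx
  obtain ⟨d, hd, hder⟩ := time_deriv_nonpos_of_isLocalMax (U := e.target) (z := z) (m := m) (k := k)
    (G := fun s => components (g s) e) (φ := fun s => v s ∘ e.symm) (f := f t ∘ e.symm)
    (S := fun y r => sigma p nl t (e.symm y) r) (ψ := ψ) (ψ' := ψ')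
    hT ht' e.open_target hz hm hp hpm (hG t)
    (fun i j => (contDiffOn_time_slice (contDiffOn_components hg he i j) hz).of_le (by norm_num))
    (fun s _ => (hG s).posDef z hz)
    (hv.contDiffOn_coord le_rfl he)
    (fun y _ => hvpos t ht' _)
    (contDiffOn_slice (hf.contDiffOn_coord ENat.LEInfty.out he) ht')
    (fun h i => by
      have : f t ∘ e.symm = fun _ => f t (e.symm z) := funext fun y => hfm h t ht' _ _
      rw [this, pd_const])
    (contDiffOn_coord (w := fun x r => sigma p nl t x r) ENat.LEInfty.out hσ he)
    (fun y hy => pressure_equation hp hT hf hu ht he hy)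
    hS hSx hSv hfl hψ hψ0 hψk
    (by
      filter_upwards [e.open_target.mem_nhds hz] with y hy
      have := hmax (e.symm y)
      rw [hq t ht' y hy, hq t ht' z hz] at this
      exact this)
  exact ⟨d, hd, hder.congr (fun s hs => hq s hs z hz) (hq t ht' z hz)⟩

/-- The weight `p² t / (1 + 2kt)` of the gradient term. -/
theorem hasDerivAt_weight {k t : ℝ} (hk : 0 ≤ k) (ht : 0 ≤ t) (p : ℝ) :
    HasDerivAt (fun s => p ^ 2 * s / (1 + 2 * k * s)) (p ^ 2 / (1 + 2 * k * t) ^ 2) t := by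
  have h0 : 1 + 2 * k * t ≠ 0 := by positivity
  have h := ((hasDerivAt_id t).const_mul (p ^ 2)).div
    (((hasDerivAt_id t).const_mul (2 * k)).const_add 1) h0
  refine h.congr_deriv ?_
  simp only [id]
  congr 1
  ring

/-- The defect is p²·2kt/(1+2kt)², so the weight is a subsolution of ψ' + 2kψ = p², and an exact
solution when k = 0. -/
theorem weight_ineq {k t : ℝ} (hk : 0 ≤ k) (ht : 0 ≤ t) (p : ℝ) :
    p ^ 2 / (1 + 2 * k * t) ^ 2 + 2 * k * (p ^ 2 * t / (1 + 2 * k * t)) ≤ p ^ 2 := by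
  have h0 : 0 < 1 + 2 * k * t := by positivity
  have h : p ^ 2 / (1 + 2 * k * t) ^ 2 + 2 * k * (p ^ 2 * t / (1 + 2 * k * t))
      = p ^ 2 - p ^ 2 * (2 * k * t) / (1 + 2 * k * t) ^ 2 := by
    field_simp; ring
  rw [h]
  have : 0 ≤ p ^ 2 * (2 * k * t) / (1 + 2 * k * t) ^ 2 := by positivity
  linarith

end Manifold

end NPME
end

/-! ### The gradient estimate. -/

open NPME
theorem corollary10p6 (n : ℕ) (hn : 2 ≤ n)
    (M : Type*) [TopologicalSpace M] [ChartedSpace (Model n) M] [IsManifold (𝓡 n) ∞ M]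
    [T2Space M] [CompactSpace M] [Nonempty M]
    (T : ℝ) (hT : 0 < T) (m : ℝ) (hm : (n : ℝ) ≤ m) (k : ℝ) (hk : 0 ≤ k)
    (p : ℝ) (hp : 1 < p) (hpm : p ≤ 1 + 1 / √(m - 1))
    (g : ℝ → Metric n M) (hg : IsC2MetricFamily T g)
    (f : ℝ → M → ℝ) (hf : IsCrOnSpaceTime n 2 T f)
    (hfm : m = n → ∀ t ∈ Set.Icc 0 T, ∀ x y : M, f t x = f t y)
    (nl : ℝ → M → ℝ → ℝ)
    (hnl : ∀ t ∈ Set.Ioc 0 T, ContMDiffOn ((𝓡 n).prod 𝓘(ℝ, ℝ)) 𝓘(ℝ, ℝ) 1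
      (fun q : M × ℝ => nl t q.1 q.2) (Set.univ ×ˢ Set.Ioi 0))
    (u : ℝ → M → ℝ) (hu : IsPositiveSmoothSolution T p g f nl u)
    (v : ℝ → M → ℝ) (hv : v = pressure p u)
    (hflow : SuperFlow T p m k g f v)
    (hS : ∀ t ∈ Set.Ioc 0 T, ∀ x : M, sigma p nl t x (v t x) ≤ 0)
    (hSx : ∀ t ∈ Set.Ioc 0 T, ∀ x : M,
      gradInner (g t) (v t) (fun y => sigma p nl t y (v t x)) x ≤ 0)
    (hSv : ∀ t ∈ Set.Ioc 0 T, ∀ x : M,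
      deriv (fun s => sigma p nl t x s) (v t x)
        + sigma p nl t x (v t x) / (2 * (p - 1) * v t x) ≤ 0) :
    ∃ V₀ : ℝ, IsGreatest (Set.range fun y : M => v 0 y ^ (p / (p - 1))) V₀ ∧
      ∀ x : M, ∀ t ∈ Set.Ioc 0 T,
        p ^ 2 * t / (1 + 2 * k * t) *
            (v t x ^ (1 / (p - 1)) * gradInner (g t) (v t) (v t) x)
          ≤ (p - 1) * (V₀ - v t x ^ (p / (p - 1))) := by
  subst hv
  have hn2 : (2 : ℝ) ≤ n := by exact_mod_cast hn
  have hb : 0 < p - 1 := by linarith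
  -- The bound p - 1 ≤ 1/√(m-1), inverted and squared.
  have hpm' : m - 1 ≤ (1 / (p - 1)) ^ 2 := by
    have hm1 : 0 < m - 1 := by linarith
    have hsq : 0 < √(m - 1) := Real.sqrt_pos.2 hm1
    have h1 : √(m - 1) ≤ 1 / (p - 1) := (le_one_div hsq hb).2 (by linarith)
    calc m - 1 = √(m - 1) ^ 2 := (Real.sq_sqrt hm1.le).symm
      _ ≤ (1 / (p - 1)) ^ 2 := by gcongr
  set v := pressure p u with hv
  have hvs : IsCrOnSpaceTime n ∞ T v := hu.smooth.pressure hu.pos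
  have hvpos : ∀ t ∈ Set.Icc 0 T, ∀ x, 0 < v t x := fun t ht x => pressure_pos hp (hu.pos t ht x)
  have h0mem : (0 : ℝ) ∈ Set.Icc 0 T := ⟨le_rfl, hT.le⟩
  have hpow : ∀ t ∈ Set.Icc 0 T, ∀ x, v t x ^ (1 / (p - 1)) * v t x = v t x ^ (p / (p - 1)) := by
    intro t ht x
    rw [← Real.rpow_add_one (hvpos t ht x).ne']
    congr 1
    field_simp
    ring
  have hcont0 : Continuous fun y : M => v 0 y ^ (p / (p - 1)) :=
    (hvs.contMDiff h0mem).continuous.rpow_const fun y => Or.inl (hvpos 0 h0mem y).ne'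
  obtain ⟨V₀, hV₀⟩ := (isCompact_range hcont0).exists_isGreatest (Set.range_nonempty _)
  refine ⟨V₀, hV₀, ?_⟩
  set ψ : ℝ → ℝ := fun s => p ^ 2 * s / (1 + 2 * k * s) with hψdef
  have hψd : ∀ t ∈ Set.Icc 0 T, HasDerivWithinAt ψ (p ^ 2 / (1 + 2 * k * t) ^ 2) (Set.Icc 0 T) t :=
    fun t ht => (hasDerivAt_weight hk ht.1 p).hasDerivWithinAt
  have hcont : ContinuousOn (fun q : M × ℝ => hamiltonQuantity p ψ g v q.2 q.1)
      (Set.univ ×ˢ Set.Icc 0 T) :=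
    continuousOn_hamiltonQuantity hT hg hvs hvpos fun t ht => (hψd t ht).continuousWithinAt
  have hbound : ∀ x : M, ∀ t ∈ Set.Icc 0 T, hamiltonQuantity p ψ g v t x ≤ (p - 1) * V₀ := by
    intro x t ht
    by_contra! hlt
    -- With this ε the excess of F over the initial bound at (x,t) is 2εT, so subtracting εt ≤ εT
    -- still leaves an excess of at least εT. The maximum of F - εt therefore cannot lie at time 0.
    set ε := (hamiltonQuantity p ψ g v t x - (p - 1) * V₀) / (2 * T) with hε
    have hεpos : 0 < ε := div_pos (by linarith) (by linarith)
    have hεT : ε * (2 * T) = hamiltonQuantity p ψ g v t x - (p - 1) * V₀ := by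
      rw [hε]; field_simp
    obtain ⟨⟨x₀, t₀⟩, ⟨-, ht₀⟩, hmax⟩ := (isCompact_univ.prod isCompact_Icc).exists_isMaxOn
      (⟨(x, t), trivial, ht⟩ : ((Set.univ : Set M) ×ˢ Set.Icc 0 T).Nonempty)
      (hcont.sub (continuousOn_const.mul continuousOn_snd :
        ContinuousOn (fun q : M × ℝ => ε * q.2) _))
    change t₀ ∈ Set.Icc 0 T at ht₀
    have hmax' : ∀ y, ∀ s ∈ Set.Icc 0 T, hamiltonQuantity p ψ g v s y - ε * s
        ≤ hamiltonQuantity p ψ g v t₀ x₀ - ε * t₀ := fun y s hs => hmax (⟨trivial, hs⟩ :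
          (y, s) ∈ (Set.univ : Set M) ×ˢ Set.Icc 0 T)
    have ht₀pos : 0 < t₀ := by
      rcases ht₀.1.eq_or_lt with h | h
      · exfalso
        have h1 := hmax' x t ht
        have h2 : hamiltonQuantity p ψ g v t₀ x₀ ≤ (p - 1) * V₀ := by
          have h3 : hamiltonQuantity p ψ g v 0 x₀ = (p - 1) * v 0 x₀ ^ (p / (p - 1)) := by
            rw [← hpow 0 h0mem]
            simp only [hamiltonQuantity, hψdef]
            ring
          rw [← h, h3]
          exact mul_le_mul_of_nonneg_left (hV₀.2 ⟨x₀, rfl⟩) hb.le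
        rw [← h] at h1 h2
        have h4 : ε * t ≤ ε * T := mul_le_mul_of_nonneg_left ht.2 hεpos.le
        have h5 : 0 < ε * T := mul_pos hεpos hT
        linarith
      · exact h
    have ht₀' : t₀ ∈ Set.Ioc 0 T := ⟨ht₀pos, ht₀.2⟩
    obtain ⟨d, hd, hder⟩ := hamiltonQuantity_time_deriv_nonpos (x := x₀) (ψ := ψ) hT ht₀' hm hp hpm'
      hg hf hfm hnl hu hflow (hS t₀ ht₀' x₀) (hSx t₀ ht₀' x₀) (hSv t₀ ht₀' x₀) (hψd t₀ ht₀)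
      (by simp only [hψdef]; positivity) (weight_ineq hk ht₀.1 p)
      (fun y => by have := hmax' y t₀ ht₀; linarith)
    -- At (x₀,t₀) the time derivative of F - εt is d - ε < 0, yet maximality in time makes it
    -- nonnegative.
    have hder' := hder.sub (((hasDerivAt_id t₀).const_mul ε).hasDerivWithinAt)
    have := nonneg_of_hasDerivWithinAt_of_isMaxOn ht₀' hder' fun s hs => hmax' x₀ s hs
    linarith
  intro x t ht
  have ht' : t ∈ Set.Icc 0 T := Set.Ioc_subset_Icc_self ht
  have h := hbound x t ht'
  have h2 : hamiltonQuantity p ψ g v t x = p ^ 2 * t / (1 + 2 * k * t) *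
      (v t x ^ (1 / (p - 1)) * gradInner (g t) (v t) (v t) x)
      + (p - 1) * v t x ^ (p / (p - 1)) := by
    rw [← hpow t ht']
    simp only [hamiltonQuantity, hψdef]
    ring
  linarith
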